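/- Let $k_1\ge l_1\ge 0$ and $k_2\ge l_2\ge 0$ be integers with $N:=k_1+l_1+k_2+l_2\ge 1$. Let $$L:=\inf_{P}\ \sup_{|z_1|^2+|z_2|^2\le 1}\left|z_1^{k_1}\bar z_1^{l_1}z_2^{k_2}\bar z_2^{l_2}-P(z_1,z_2)\right|,\qquad \Lambda:=1/L,$$ where $P$ runs over all polynomials in $z_1,\bar z_1,z_2,\bar z_2$ with complex coefficients of total degree less than $N$. Put $n=l_1+l_2$, $\alpha=\frac{k_1-l_1}{2}$, $\beta=\frac{k_2-l_2}{2}$, and let $$\Omega_n(\alpha,\beta)=\left\{u+iv:\ -\beta<\tfrac v\pi<\alpha+n\right\}\setminus\bigcup_{j=0}^{n}\left\{u+iv:\ \tfrac v\pi=j,\ u\le 0\right\}.$$ Then $L>0$. There is a unique conformal bijection $w$ of the upper half-plane $\mathbb C_+$ onto $\Omega_n(\alpha,\beta)$ with the following boundary behaviour ($z\in\mathbb C_+$): - as $z\to 0$, $\operatorname{Re}w(z)\to-\infty$ with $n<\frac{1}{\pi}\operatorname{Im}w(z)<n+\alpha$ for $z$ close to $0$ (if $\alpha=0$: $w(z)\to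 n\pi i$ instead); - as $z\to 1$, $\operatorname{Re}w(z)\to-\infty$ with $-\beta<\frac{1}{\pi}\operatorname{Im}w(z)<0$ for $z$ close to $1$ (if $\beta=0$: $w(z)\to 0$ instead); - as $z\to\infty$, $\operatorname{Re}w(z)\to+\infty$. There is a unique real constant $C_n(\alpha,\beta)$ such that, as $z\to\infty$ in $\mathbb C_+$, $$w(z)=(\alpha+\beta+n)\ln z+C_n(\alpha,\beta)-\beta\pi i+O(1/z)\qquad(0<\arg z<\pi),$$ and $$\ln\Lambda=C_{l_1+l_2}\left(\frac{k_1-l_1}{2},\frac{k_2-l_2}{2}\right).$$ -/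

import Mathlib

noncomputable section

open Filter Topology Complex

namespace Comb

/-! ### Minimal deviation of a monomial on the complex ball -/

/-- The closed unit ball of `ℂ²`, `|z₁|² + |z₂|² ≤ 1`. -/
def ball : Set (ℂ × ℂ) := {z | ‖z.1‖ ^ 2 + ‖z.2‖ ^ 2 ≤ 1}

/-- The value at `(z₁, z₂)` of a (non-analytic) complex polynomial in `z₁, z̄₁, z₂, z̄₂`:
the four variables stand, in this order, for `z₁, z̄₁, z₂, z̄₂`. -/
def value (P : MvPolynomial (Fin 4) ℂ) (z : ℂ × ℂ) : ℂ :=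
  MvPolynomial.eval ![z.1, starRingEnd ℂ z.1, z.2, starRingEnd ℂ z.2] P

/-- The uniform norm on the closed unit ball. -/
def supNorm (P : MvPolynomial (Fin 4) ℂ) : ℝ := ⨆ z : ball, ‖value P z‖

/-- The monomial `z₁^k₁ z̄₁^l₁ z₂^k₂ z̄₂^l₂`. -/
def mono (k₁ l₁ k₂ l₂ : ℕ) : MvPolynomial (Fin 4) ℂ :=
  MvPolynomial.X 0 ^ k₁ * MvPolynomial.X 1 ^ l₁ * MvPolynomial.X 2 ^ k₂ * MvPolynomial.X 3 ^ l₂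

/-- The minimal deviation `L` of the monomial from the polynomials of smaller total degree. -/
def minDeviation (k₁ l₁ k₂ l₂ : ℕ) : ℝ :=
  ⨅ P : {P : MvPolynomial (Fin 4) ℂ // P.totalDegree < k₁ + l₁ + k₂ + l₂},
    supNorm (mono k₁ l₁ k₂ l₂ - P.1)

/-- `Λ = 1 / L`. -/
def recipDeviation (k₁ l₁ k₂ l₂ : ℕ) : ℝ := 1 / minDeviation k₁ l₁ k₂ l₂

/-! ### Conformal maps onto comb domains -/

/-- The open upper half-plane. -/
def upperHalf : Set ℂ := {z | 0 < z.im}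

/-- The comb domain `Ω_n(α, β)`: a horizontal strip with `n + 1` horizontal cuts
(the top cut lies on the boundary line if `α = 0`, the bottom one if `β = 0`). -/
def domain (n : ℕ) (α β : ℝ) : Set ℂ :=
  {w | -β < w.im / Real.pi ∧ w.im / Real.pi < α + n} \
    ⋃ j : Fin (n + 1), {w | w.im / Real.pi = (j : ℕ) ∧ w.re ≤ 0}

/-- `w` is the conformal map of the upper half-plane onto `Ω_n(α, β)` with
`w(0) = ∞₀`, `w(1) = ∞_{n+1}`, `w(∞) = ∞_{n+2}`. These boundary elements are the left end of the
top strip `n < v/π < n + α`, the left end of the bottom strip `-β < v/π < 0`, and the right end of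
the whole strip. When `α = 0` the top strip is void and `∞₀` is replaced by the end point `nπi` of
the top cut; when `β = 0` the bottom strip is void and `∞_{n+1}` is replaced by the end point `0`
of the bottom cut. -/
structure IsMap (n : ℕ) (α β : ℝ) (w : ℂ → ℂ) : Prop where
  differentiableOn : DifferentiableOn ℂ w upperHalf
  bijOn : Set.BijOn w upperHalf (domain n α β)
  at_zero_of_pos : 0 < α →
    Tendsto (fun z => (w z).re) (𝓝[upperHalf] 0) atBot ∧
    ∀ᶠ z in 𝓝[upperHalf] 0, (n : ℝ) < (w z).im / Real.pi ∧ (w z).im / Real.pi < n + α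
  at_zero_of_eq : α = 0 → Tendsto w (𝓝[upperHalf] 0) (𝓝 ((n : ℂ) * Real.pi * I))
  at_one_of_pos : 0 < β →
    Tendsto (fun z => (w z).re) (𝓝[upperHalf] 1) atBot ∧
    ∀ᶠ z in 𝓝[upperHalf] 1, -β < (w z).im / Real.pi ∧ (w z).im / Real.pi < 0
  at_one_of_eq : β = 0 → Tendsto w (𝓝[upperHalf] 1) (𝓝 0)
  at_infty : Tendsto (fun z => (w z).re) (Bornology.cobounded ℂ ⊓ 𝓟 upperHalf) atTop

/-- The expansion `w(z) = (α + β + n) ln z + C - βπi + O(1/z)` as `z → ∞` in the upper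
half-plane, with `0 < arg z < π`. -/
def HasExpansion (n : ℕ) (α β : ℝ) (w : ℂ → ℂ) (C : ℝ) : Prop :=
  (fun z : ℂ => w z - (((α + β + n : ℝ) : ℂ) * Complex.log z + (C : ℂ) - (β : ℂ) * Real.pi * I))
    =O[Bornology.cobounded ℂ ⊓ 𝓟 upperHalf] fun z : ℂ => 1 / z

/-- The constant `C_n(α, β)` of the expansion at infinity of the normalized conformal map. -/
def constant (n : ℕ) (α β : ℝ) : ℝ :=
  Classical.epsilon fun C : ℝ => ∃ w : ℂ → ℂ, IsMap n α β w ∧ HasExpansion n α β w C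

end Comb

end

/-! The torus acting on the two variables preserves the ball. Averaging against the character of
weight (k₁ - l₁, k₂ - l₂) and restricting to |z₁|² = t, |z₂|² = 1 - t turns the problem into a
weighted Chebyshev problem on [0, 1]: minimise the maximum M of t^α (1 - t)^β |q(t)| over monic q of
degree n. The extremal q has n simple zeros interlaced with n + 1 points where the maximum is
attained (`exists_isChebyshev`, by perturbing zeros). Lagrange interpolation at these points shows
that no competitor does better (`le_of_monic`), so L ≥ M. Conversely, the l₁ smallest zeros are used
for factors in |z₁|² and the l₂ largest for factors in |z₂|². The resulting polynomial is bounded by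
M on the whole ball and not only on the sphere (`factors_le`). Hence L = M (`minDeviation_eq`).

The same zeros give the conformal map explicitly: w(z) = α log z + β log(z - 1) + ∑ log(z - x_j) -
log M - βπi. It is injective because Im w' < 0. On [0, 1] its boundary values have real part
log(weighted modulus / M) ≤ 0, while Im w / π counts the zeros to the right; so [0, 1] produces
exactly the cuts, and equioscillation is what makes every cut end at real part 0. The image is
therefore the comb domain (`bijOn_combMap`), and the expansion at infinity has constant -log M. Any
other normalized map differs from this one by an automorphism of the half-plane fixing 0, 1 and ∞,
which is the identity (`eqOn_combMap`). So the constant is well defined and equals ln(1/M) = ln Λ.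
-/

noncomputable section

namespace Comb

/-! ### Injective holomorphic maps and automorphisms of the upper half-plane. -/

section HalfPlane

open Filter Topology Complex Set

lemma isOpen_upperHalf : IsOpen upperHalf := isOpen_lt continuous_const continuous_im

lemma convex_upperHalf : Convex ℝ upperHalf := convex_halfSpace_im_gt 0

/-- An injective holomorphic function has nonvanishing derivative. -/
lemma deriv_ne_zero_of_injOn {f : ℂ → ℂ} {U : Set ℂ} (hU : IsOpen U)
    (hf : DifferentiableOn ℂ f U) (hinj : InjOn f U) {a : ℂ} (ha : a ∈ U) : deriv f a ≠ 0 := by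
  intro h0
  have hUa : U ∈ 𝓝 a := hU.mem_nhds ha
  have han : AnalyticAt ℂ f a := hf.analyticAt hUa
  have hsub : AnalyticAt ℂ (fun z => f z - f a) a := han.sub analyticAt_const
  have hnc : ¬ ∀ᶠ z in 𝓝 a, f z - f a = 0 := by
    intro h
    have h2 : ∀ᶠ z in 𝓝[≠] a, z = a := by
      filter_upwards [nhdsWithin_le_nhds h, nhdsWithin_le_nhds hUa] with z hz hzU
      exact hinj hzU ha (sub_eq_zero.1 hz)
    obtain ⟨z, hz, hz'⟩ := (h2.and self_mem_nhdsWithin).exists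
    exact hz' hz
  -- Local normal form f - f a = (z - a)^n h with h a ≠ 0. The order n is neither 0 (the left side
  -- vanishes at a) nor 1 (the derivative vanishes at a).
  obtain ⟨n, h, han', hne, heq⟩ := (hsub.exists_eventuallyEq_pow_smul_nonzero_iff).2 hnc
  have hn0 : n ≠ 0 := by
    rintro rfl
    have := heq.self_of_nhds
    simp at this
    exact hne this.symm
  have hn1 : n ≠ 1 := by
    rintro rfl
    have h1 : HasDerivAt (fun z => f z - f a) 0 a := by
      have := (han.differentiableAt.hasDerivAt).sub_const (f a)
      rwa [h0] at this
    have h2 : HasDerivAt (fun z => (z - a) ^ 1 • h z) (h a) a := by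
      have := HasDerivAt.fun_mul ((hasDerivAt_id' a).sub_const a) han'.differentiableAt.hasDerivAt
      simpa using this
    exact hne (h2.unique (h1.congr_of_eventuallyEq (heq.mono fun z hz => hz.symm)))
  -- an `n`-th root of `h` near `a`
  obtain ⟨c, hc⟩ := IsAlgClosed.exists_pow_nat_eq (h a) (Nat.pos_of_ne_zero hn0)
  have hc0 : c ≠ 0 := by rintro rfl; rw [zero_pow hn0] at hc; exact hne hc.symm
  set k : ℂ → ℂ := fun z => c * (h z / h a) ^ ((n : ℂ)⁻¹) with hk
  have hkan : AnalyticAt ℂ k a := by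
    refine analyticAt_const.mul (AnalyticAt.cpow (han'.div analyticAt_const hne) analyticAt_const ?_)
    rw [div_self hne]; simp
  have hka : k a = c := by simp [hk, hne]
  have hkn : ∀ z, k z ^ n = h z := by
    intro z
    rw [hk, mul_pow, cpow_nat_inv_pow _ hn0, hc]
    field_simp
  -- Near a, f - f a = s^n, and s is a local homeomorphism since its derivative at a is c ≠ 0.
  set s : ℂ → ℂ := fun z => (z - a) * k z with hs
  have hsan : AnalyticAt ℂ s a := (analyticAt_id.sub analyticAt_const).mul hkan
  have hsd : HasStrictDerivAt s c a := by
    have h1 : HasDerivAt s (k a) a := by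
      have := HasDerivAt.fun_mul ((hasDerivAt_id' a).sub_const a) hkan.differentiableAt.hasDerivAt
      simpa [hs] using this
    have := hsan.hasStrictDerivAt
    rwa [h1.deriv, hka] at this
  have hsa : s a = 0 := by simp [hs]
  have hmap := hsd.map_nhds_eq hc0
  rw [hsa] at hmap
  have hV : ∀ᶠ y in 𝓝 (0 : ℂ), ∃ z ∈ U, f z - f a = s z ^ n ∧ s z = y := by
    rw [← hmap]
    have : ∀ᶠ z in 𝓝 a, z ∈ U ∧ f z - f a = s z ^ n := by
      filter_upwards [hUa, heq] with z hz hz'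
      refine ⟨hz, ?_⟩
      rw [hz', hs, mul_pow, hkn, smul_eq_mul]
    exact (eventually_map.2 (this.mono fun z hz => ⟨z, hz.1, hz.2, rfl⟩))
  -- The points where s takes the values y and ωy have the same image under f; for y ≠ 0 and ω ≠ 1
  -- they are distinct, against injectivity.
  obtain ⟨ω, hω⟩ : ∃ ω : ℂ, IsPrimitiveRoot ω n := ⟨_, Complex.isPrimitiveRoot_exp n hn0⟩
  have hω1 : ω ≠ 1 := by
    rintro rfl
    exact hn1 (Nat.dvd_one.1 ((hω.pow_eq_one_iff_dvd 1).1 (by simp)))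
  have hVω : ∀ᶠ y in 𝓝 (0 : ℂ), ∃ z ∈ U, f z - f a = s z ^ n ∧ s z = ω * y := by
    have : Tendsto (fun y : ℂ => ω * y) (𝓝 0) (𝓝 0) := by
      have : Continuous fun y : ℂ => ω * y := by fun_prop
      simpa using this.tendsto 0
    exact this.eventually hV
  have hboth : ∀ᶠ y in 𝓝[≠] (0 : ℂ), _ := nhdsWithin_le_nhds (hV.and hVω)
  obtain ⟨y, ⟨⟨z, hz, hfz, hsz⟩, z', hz', hfz', hsz'⟩, hy⟩ :=
    (hboth.and self_mem_nhdsWithin).exists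
  have : z = z' := by
    apply hinj hz hz'
    have : f z - f a = f z' - f a := by
      rw [hfz, hfz', hsz, hsz', mul_pow, hω.pow_eq_one, one_mul]
    exact sub_left_inj.1 this
  subst this
  rw [hsz] at hsz'
  have hy0 : y ≠ 0 := hy
  exact hω1 (mul_right_cancel₀ hy0 (by rw [one_mul]; exact hsz'.symm))

/-- The inverse of an injective holomorphic function is holomorphic. -/
lemma differentiableOn_invFunOn {f : ℂ → ℂ} {U V : Set ℂ} (hU : IsOpen U)
    (hf : DifferentiableOn ℂ f U) (hbij : BijOn f U V) :
    DifferentiableOn ℂ (Function.invFunOn f U) V := by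
  intro v hv
  obtain ⟨a, ha, rfl⟩ := hbij.surjOn hv
  have hd := deriv_ne_zero_of_injOn hU hf hbij.injOn ha
  have hs : HasStrictDerivAt f (deriv f a) a :=
    (hf.analyticAt (hU.mem_nhds ha)).hasStrictDerivAt
  have hl : ∀ᶠ x in 𝓝 a, Function.invFunOn f U (f x) = x := by
    filter_upwards [hU.mem_nhds ha] with x hx
    exact hbij.injOn.leftInvOn_invFunOn hx
  exact (hs.to_local_left_inverse hd hl).hasDerivAt.differentiableAt.differentiableWithinAt

/-- The Cayley transform. -/
def cayley (z : ℂ) : ℂ := (z - I) / (z + I)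

/-- The inverse of the Cayley transform. -/
def cayleyInv (z : ℂ) : ℂ := I * (1 + z) / (1 - z)

lemma add_I_ne_zero {z : ℂ} (hz : z ∈ upperHalf) : z + I ≠ 0 := by
  intro h
  have := congrArg im h
  have hz' : 0 < z.im := hz
  simp at this
  linarith

lemma one_sub_ne_zero_of_mem_ball {z : ℂ} (hz : z ∈ Metric.ball (0 : ℂ) 1) : 1 - z ≠ 0 := by
  intro h
  have : z = 1 := (sub_eq_zero.1 h).symm
  simp [this] at hz

lemma cayley_mem_ball {z : ℂ} (hz : z ∈ upperHalf) : cayley z ∈ Metric.ball (0 : ℂ) 1 := by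
  have hz' : 0 < z.im := hz
  rw [mem_ball_zero_iff, cayley, norm_div, div_lt_one (norm_pos_iff.2 (add_I_ne_zero hz))]
  rw [← sq_lt_sq₀ (norm_nonneg _) (norm_nonneg _), ← normSq_eq_norm_sq, ← normSq_eq_norm_sq,
    normSq_apply, normSq_apply]
  simp
  nlinarith

lemma cayleyInv_mem {z : ℂ} (hz : z ∈ Metric.ball (0 : ℂ) 1) : cayleyInv z ∈ upperHalf := by
  have h1 := one_sub_ne_zero_of_mem_ball hz
  have hn : normSq z < 1 := by
    rw [mem_ball_zero_iff] at hz
    rw [normSq_eq_norm_sq]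
    nlinarith [norm_nonneg z]
  have h2 : 0 < normSq (1 - z) := normSq_pos.2 h1
  have : (cayleyInv z).im = (1 - normSq z) / normSq (1 - z) := by
    rw [cayleyInv, div_im, normSq_apply z]
    simp
    field_simp
    ring
  show 0 < (cayleyInv z).im
  rw [this]
  exact div_pos (by linarith) h2

lemma cayley_cayleyInv {z : ℂ} (hz : z ∈ Metric.ball (0 : ℂ) 1) : cayley (cayleyInv z) = z := by
  have h1 := one_sub_ne_zero_of_mem_ball hz
  have h2 := add_I_ne_zero (cayleyInv_mem hz)
  rw [cayley, div_eq_iff h2, cayleyInv]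
  field_simp
  ring

lemma cayleyInv_cayley {z : ℂ} (hz : z ∈ upperHalf) : cayleyInv (cayley z) = z := by
  have h1 := one_sub_ne_zero_of_mem_ball (cayley_mem_ball hz)
  have h2 := add_I_ne_zero hz
  rw [cayleyInv, div_eq_iff h1, cayley]
  field_simp
  ring

lemma I_mem_upperHalf : I ∈ upperHalf := by simp [upperHalf]

lemma differentiableOn_cayley : DifferentiableOn ℂ cayley upperHalf := fun _ hz =>
  ((differentiableAt_id.sub_const I).div (differentiableAt_id.add_const I)
    (add_I_ne_zero hz)).differentiableWithinAt

lemma differentiableOn_cayleyInv : DifferentiableOn ℂ cayleyInv (Metric.ball 0 1) := fun _ hz =>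
  (((differentiableAt_id.const_add 1).const_mul I).div (differentiableAt_id.const_sub 1)
    (one_sub_ne_zero_of_mem_ball hz)).differentiableWithinAt

/-- A self-map of the upper half-plane, transported to the unit disc. -/
lemma cayley_conj {f : ℂ → ℂ} (hf : DifferentiableOn ℂ f upperHalf)
    (hm : MapsTo f upperHalf upperHalf) (hI : f I = I) :
    DifferentiableOn ℂ (cayley ∘ f ∘ cayleyInv) (Metric.ball 0 1) ∧
    MapsTo (cayley ∘ f ∘ cayleyInv) (Metric.ball 0 1) (Metric.ball 0 1) ∧
    (cayley ∘ f ∘ cayleyInv) 0 = 0 := by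
  have hci : MapsTo cayleyInv (Metric.ball 0 1) upperHalf := fun _ hz => cayleyInv_mem hz
  refine ⟨differentiableOn_cayley.comp (hf.comp differentiableOn_cayleyInv hci) (hm.comp hci),
    fun _ hz => cayley_mem_ball (hm (hci hz)), ?_⟩
  have : cayleyInv 0 = I := by simp [cayleyInv]
  simp [this, hI, cayley]

lemma tendsto_cayley : Tendsto cayley (Bornology.cobounded ℂ) (𝓝 1) := by
  have h1 : Tendsto (fun z : ℂ => 1 - 2 * I * (z + I)⁻¹) (Bornology.cobounded ℂ) (𝓝 (1 - 2 * I * 0)) :=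
    tendsto_const_nhds.sub (tendsto_const_nhds.mul
      (tendsto_inv₀_cobounded.comp (tendsto_add_const_cobounded I)))
  simp only [mul_zero, sub_zero] at h1
  refine h1.congr' ?_
  have : ∀ᶠ z : ℂ in Bornology.cobounded ℂ, z ≠ -I := Bornology.eventually_ne_cobounded (-I)
  filter_upwards [this] with z hz
  have : z + I ≠ 0 := fun h => hz (eq_neg_of_add_eq_zero_left h)
  rw [cayley]
  field_simp
  ring

/-- Makes limits at infinity inside the half-plane unique; the imaginary axis is a witness. -/
instance cobounded_inf_upperHalf_neBot : (Bornology.cobounded ℂ ⊓ 𝓟 upperHalf).NeBot := by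
  have h : Tendsto (fun t : ℝ => (t : ℂ) * I) atTop (Bornology.cobounded ℂ ⊓ 𝓟 upperHalf) := by
    refine tendsto_inf.2 ⟨?_, tendsto_principal.2 ?_⟩
    · rw [← tendsto_norm_atTop_iff_cobounded]
      simpa using tendsto_abs_atTop_atTop
    · filter_upwards [eventually_gt_atTop 0] with t ht
      simpa [upperHalf] using ht
  exact h.neBot

/-- A holomorphic automorphism of the upper half-plane fixing `I` and `∞` is the identity. -/
lemma eq_self_of_fix_I_infty {φ ψ : ℂ → ℂ} (hφ : DifferentiableOn ℂ φ upperHalf)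
    (hψ : DifferentiableOn ℂ ψ upperHalf) (hφm : MapsTo φ upperHalf upperHalf)
    (hψm : MapsTo ψ upperHalf upperHalf) (hl : ∀ z ∈ upperHalf, ψ (φ z) = z)
    (hI : φ I = I)
    (hinf : Tendsto φ (Bornology.cobounded ℂ ⊓ 𝓟 upperHalf) (Bornology.cobounded ℂ)) :
    ∀ z ∈ upperHalf, φ z = z := by
  have hI' : ψ I = I := by rw [← hI, hl I I_mem_upperHalf]; exact hI.symm ▸ rfl
  obtain ⟨d1, m1, z1⟩ := cayley_conj hφ hφm hI
  obtain ⟨d2, m2, z2⟩ := cayley_conj hψ hψm hI'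
  set g := cayley ∘ φ ∘ cayleyInv with hg
  -- The Schwarz lemma, applied to g and to its left inverse.
  have hnorm : ∀ z ∈ Metric.ball (0 : ℂ) 1, ‖g z‖ = ‖z‖ := by
    intro z hz
    have hzn : ‖z‖ < 1 := mem_ball_zero_iff.1 hz
    apply le_antisymm
    · exact Complex.norm_le_norm_of_mapsTo_ball d1 (m1.mono_right Metric.ball_subset_closedBall) z1 hzn
    · have h3 := Complex.norm_le_norm_of_mapsTo_ball d2 (m2.mono_right Metric.ball_subset_closedBall) z2
        (mem_ball_zero_iff.1 (m1 hz))
      have h4 : (cayley ∘ ψ ∘ cayleyInv) (g z) = z := by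
        simp only [hg, Function.comp_apply]
        rw [cayleyInv_cayley (hφm (cayleyInv_mem hz)), hl _ (cayleyInv_mem hz), cayley_cayleyInv hz]
      rwa [h4] at h3
  have hhalf : (1 / 2 : ℂ) ∈ Metric.ball (0 : ℂ) 1 := by
    -- Equality in the Schwarz lemma at one nonzero point makes g a rotation; 1/2 is an arbitrary
    -- choice.
    rw [mem_ball_zero_iff]; norm_num
  obtain ⟨C, -, hC⟩ := Complex.affine_of_mapsTo_ball_of_exists_norm_dslope_eq_div' (R₂ := 1) d1
    (by rw [z1]; exact m1.mono_right Metric.ball_subset_closedBall)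
    ⟨1 / 2, hhalf, by
      rw [dslope_of_ne _ (by norm_num), slope_def_field, z1, sub_zero, sub_zero, norm_div,
        hnorm _ hhalf]
      norm_num⟩
  have hcay : ∀ z ∈ upperHalf, cayley (φ z) = cayley z * C := by
    intro z hz
    have := hC (cayley_mem_ball hz)
    simp only [hg, sub_zero, smul_eq_mul, Function.comp_apply] at this
    rw [cayleyInv_cayley hz] at this
    simpa [cayleyInv, hI, cayley] using this
  -- The Cayley transform sends ∞ to the boundary point 1, which the rotation must fix.
  have hC1 : C = 1 := by
    have t1 : Tendsto (fun z => cayley (φ z)) (Bornology.cobounded ℂ ⊓ 𝓟 upperHalf) (𝓝 1) :=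
      tendsto_cayley.comp hinf
    have t2 : Tendsto (fun z => cayley z * C) (Bornology.cobounded ℂ ⊓ 𝓟 upperHalf) (𝓝 (1 * C)) :=
      (tendsto_cayley.mono_left inf_le_left).mul_const C
    have t3 : Tendsto (fun z => cayley (φ z)) (Bornology.cobounded ℂ ⊓ 𝓟 upperHalf) (𝓝 (1 * C)) := by
      refine t2.congr' ?_
      filter_upwards [mem_inf_of_right (mem_principal_self _)] with z hz
      exact (hcay z hz).symm
    simpa using tendsto_nhds_unique t3 t1
  intro z hz
  have := hcay z hz
  rw [hC1, mul_one] at this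
  rw [← cayleyInv_cayley (hφm hz), this, cayleyInv_cayley hz]

/-- The approach to the real point `t` along the vertical line. -/
lemma tendsto_vertical (t : ℝ) :
    Tendsto (fun s : ℝ => (t : ℂ) + s * I) (𝓝[>] 0) (𝓝[upperHalf] (t : ℂ)) := by
  refine tendsto_nhdsWithin_iff.2 ⟨?_, ?_⟩
  · have : Continuous fun s : ℝ => (t : ℂ) + (s : ℂ) * I := by fun_prop
    have := this.tendsto 0
    simp only [ofReal_zero, zero_mul, add_zero] at this
    exact this.mono_left nhdsWithin_le_nhds
  · filter_upwards [self_mem_nhdsWithin] with s hs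
    simpa [upperHalf] using hs

lemma nhdsWithin_upperHalf_neBot (t : ℝ) : (𝓝[upperHalf] (t : ℂ)).NeBot :=
  (tendsto_vertical t).neBot

/-- A holomorphic automorphism of the upper half-plane fixing `0`, `1` and `∞` is the identity. -/
lemma eq_self_of_fix_zero_one_infty {φ ψ : ℂ → ℂ} (hφ : DifferentiableOn ℂ φ upperHalf)
    (hψ : DifferentiableOn ℂ ψ upperHalf) (hφm : MapsTo φ upperHalf upperHalf)
    (hψm : MapsTo ψ upperHalf upperHalf) (hl : ∀ z ∈ upperHalf, ψ (φ z) = z)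
    (h0 : Tendsto φ (𝓝[upperHalf] 0) (𝓝 0)) (h1 : Tendsto φ (𝓝[upperHalf] 1) (𝓝 1))
    (hinf : Tendsto φ (Bornology.cobounded ℂ ⊓ 𝓟 upperHalf) (Bornology.cobounded ℂ)) :
    ∀ z ∈ upperHalf, φ z = z := by
  set a := (φ I).re with ha
  set b := (φ I).im with hb
  have hb0 : 0 < b := hφm I_mem_upperHalf
  have hbC : (b : ℂ) ≠ 0 := ofReal_ne_zero.2 hb0.ne'
  have hφI : φ I = (a : ℂ) + b * I := (re_add_im (φ I)).symm
  -- Following φ by the affine automorphism that brings φ I back to I reduces to the previous case,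
  -- so φ is affine; the limits at 0 and 1 then determine it.
  have key : ∀ z ∈ upperHalf, (φ z - a) / b = z := by
    refine eq_self_of_fix_I_infty (φ := fun z => (φ z - a) / b)
      (ψ := fun z => ψ (a + b * z)) ?_ ?_ ?_ ?_ ?_ ?_ ?_
    · exact (hφ.sub_const _).div_const _
    · refine hψ.comp (f := fun z : ℂ => (a : ℂ) + b * z)
        ((differentiable_id.const_mul (b : ℂ)).const_add (a : ℂ)).differentiableOn ?_
      intro z hz
      have hz' : 0 < z.im := hz
      simp only [upperHalf, mem_ofPred_eq, add_im, ofReal_im, mul_im, ofReal_re, zero_mul, add_zero,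
        zero_add]
      positivity
    · intro z hz
      have hz' : 0 < (φ z).im := hφm hz
      simp only [upperHalf, mem_ofPred_eq, div_ofReal_im, sub_im, ofReal_im, sub_zero]
      positivity
    · intro z hz
      apply hψm
      have hz' : 0 < z.im := hz
      simp only [upperHalf, mem_ofPred_eq, add_im, ofReal_im, mul_im, ofReal_re, zero_mul, add_zero,
        zero_add]
      positivity
    · intro z hz
      have : (a : ℂ) + b * ((φ z - a) / b) = φ z := by field_simp; ring
      simp only [this]
      exact hl z hz
    · rw [hφI]; field_simp; ring
    · have h2 : Tendsto (fun z : ℂ => (z - a) / b) (Bornology.cobounded ℂ) (Bornology.cobounded ℂ) := by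
        have h3 : Tendsto (fun z : ℂ => z - a) (Bornology.cobounded ℂ) (Bornology.cobounded ℂ) := by
          simp [sub_eq_add_neg]
        have h4 : Tendsto (fun z : ℂ => z * (b : ℂ)⁻¹) (Bornology.cobounded ℂ) (Bornology.cobounded ℂ) :=
          Filter.tendsto_mul_right_cobounded (inv_ne_zero hbC)
        exact h4.comp h3
      exact h2.comp hinf
  have hlin : ∀ z ∈ upperHalf, φ z = a + b * z := by
    intro z hz
    have := key z hz
    rw [div_eq_iff hbC] at this
    linear_combination this
  have lim : ∀ t : ℝ, Tendsto φ (𝓝[upperHalf] (t : ℂ)) (𝓝 (a + b * t)) := by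
    intro t
    have : Continuous fun z : ℂ => (a : ℂ) + b * z := by fun_prop
    refine ((this.tendsto t).mono_left nhdsWithin_le_nhds).congr' ?_
    filter_upwards [self_mem_nhdsWithin] with z hz
    exact (hlin z hz).symm
  have hn0 := nhdsWithin_upperHalf_neBot 0
  have hn1 := nhdsWithin_upperHalf_neBot 1
  have l0 := lim 0
  have l1 := lim 1
  simp only [ofReal_zero, ofReal_one] at *
  have e0 := tendsto_nhds_unique l0 h0
  have e1 := tendsto_nhds_unique l1 h1
  intro z hz
  rw [hlin z hz]
  linear_combination (1 - z) * e0 + z * e1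

end HalfPlane

section Extremal

open Filter Topology Set

/-! ### Weighted Chebyshev polynomials on the unit interval -/

/-- The modulus of the monic polynomial with zeros `x j`, with the weight `t ^ α (1 - t) ^ β`. -/
def weighted (α β : ℝ) {n : ℕ} (x : Fin n → ℝ) (t : ℝ) : ℝ :=
  t ^ α * (1 - t) ^ β * ∏ j, |t - x j|

lemma continuous_weighted {α β : ℝ} (hα : 0 ≤ α) (hβ : 0 ≤ β) (n : ℕ) :
    Continuous fun p : (Fin n → ℝ) × ℝ => weighted α β p.1 p.2 := by
  unfold weighted
  refine ((continuous_snd.rpow_const fun _ => Or.inr hα).mul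
    ((continuous_const.sub continuous_snd).rpow_const fun _ => Or.inr hβ)).mul ?_
  fun_prop

lemma continuous_weighted_right {α β : ℝ} (hα : 0 ≤ α) (hβ : 0 ≤ β) {n : ℕ} (x : Fin n → ℝ) :
    Continuous fun t => weighted α β x t :=
  (continuous_weighted hα hβ n).comp (Continuous.prodMk_right x)

lemma weight_nonneg (α β : ℝ) {t : ℝ} (ht : t ∈ Icc (0 : ℝ) 1) : 0 ≤ t ^ α * (1 - t) ^ β :=
  mul_nonneg (Real.rpow_nonneg ht.1 _) (Real.rpow_nonneg (sub_nonneg.2 ht.2) _)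

/-- Moving finitely many zeros so that the product of their distances to `s` decreases. -/
lemma weighted_lt_of_prod_lt {α β M : ℝ} {n : ℕ} {x y : Fin n → ℝ} (S : Finset (Fin n))
    (h : ∀ j ∉ S, y j = x j) {s : ℝ} (hS : ∏ j ∈ S, |s - y j| < ∏ j ∈ S, |s - x j|)
    (hs : s ∈ Icc (0 : ℝ) 1) (hM : weighted α β x s ≤ M) (hM0 : 0 < M) :
    weighted α β y s < M := by
  classical
  have hc : ∏ j ∈ Sᶜ, |s - y j| = ∏ j ∈ Sᶜ, |s - x j| :=
    Finset.prod_congr rfl fun j hj => by rw [h j (Finset.mem_compl.1 hj)]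
  have hx : weighted α β x s
      = (s ^ α * (1 - s) ^ β * ∏ j ∈ Sᶜ, |s - x j|) * ∏ j ∈ S, |s - x j| := by
    rw [weighted, ← Finset.prod_compl_mul_prod S]; ring
  have hy : weighted α β y s
      = (s ^ α * (1 - s) ^ β * ∏ j ∈ Sᶜ, |s - x j|) * ∏ j ∈ S, |s - y j| := by
    rw [weighted, ← Finset.prod_compl_mul_prod S, hc]; ring
  have hn : 0 ≤ s ^ α * (1 - s) ^ β * ∏ j ∈ Sᶜ, |s - x j| :=
    mul_nonneg (weight_nonneg α β hs) (Finset.prod_nonneg fun j _ => abs_nonneg _)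
  rcases hn.eq_or_lt with h0 | h0
  · rw [hy, ← h0, zero_mul]; exact hM0
  · rw [hy]
    exact (mul_lt_mul_of_pos_left hS h0).trans_le (hx ▸ hM)

/-- The maximum over [0, 1] depends continuously on the zeros, so it has a minimiser in the compact
cube. Clamping zeros to [0, 1] only shortens distances to points of [0, 1], so the minimum is
global. Sorting the zeros does not change the product. -/
lemma exists_min_sup {α β : ℝ} (hα : 0 ≤ α) (hβ : 0 ≤ β) (n : ℕ) :
    ∃ (x : Fin n → ℝ) (M : ℝ), Monotone x ∧ 0 < M ∧ (∀ t ∈ Icc (0 : ℝ) 1, weighted α β x t ≤ M) ∧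
      ∀ y : Fin n → ℝ, ∃ t ∈ Icc (0 : ℝ) 1, M ≤ weighted α β y t := by
  set F : (Fin n → ℝ) → ℝ := fun x => sSup (weighted α β x '' Icc (0 : ℝ) 1) with hF
  have hFc : Continuous F := isCompact_Icc.continuous_sSup (continuous_weighted hα hβ n)
  have hcont : ∀ y : Fin n → ℝ, ContinuousOn (weighted α β y) (Icc 0 1) := fun y =>
    (continuous_weighted_right hα hβ y).continuousOn
  have hle : ∀ y : Fin n → ℝ, ∀ t ∈ Icc (0 : ℝ) 1, weighted α β y t ≤ F y := fun y t ht =>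
    le_csSup (isCompact_Icc.bddAbove_image (hcont y)) (mem_image_of_mem _ ht)
  have hatt : ∀ y : Fin n → ℝ, ∃ t ∈ Icc (0 : ℝ) 1, F y = weighted α β y t := fun y =>
    isCompact_Icc.exists_sSup_image_eq ⟨0, by simp⟩ (hcont y)
  obtain ⟨x₀, hx₀, hmin⟩ := (isCompact_Icc (a := (0 : Fin n → ℝ)) (b := 1)).exists_isMinOn
    ⟨0, by simp⟩ hFc.continuousOn
  have hmin' : ∀ y, F x₀ ≤ F y := by
    intro y
    have h1 : F x₀ ≤ F fun j => max 0 (min 1 (y j)) := hmin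
      ⟨fun j => le_max_left _ _, fun j => max_le zero_le_one (min_le_left _ _)⟩
    refine h1.trans ?_
    obtain ⟨t, ht, hte⟩ := hatt fun j => max 0 (min 1 (y j))
    rw [hte]
    refine le_trans ?_ (hle y t ht)
    unfold weighted
    refine mul_le_mul_of_nonneg_left ?_ (weight_nonneg α β ht)
    refine Finset.prod_le_prod (fun j _ => abs_nonneg _) fun j _ => ?_
    have := ht.1
    have := ht.2
    grind
  set x := x₀ ∘ Tuple.sort x₀ with hx
  have hFx : F x = F x₀ := by
    have : weighted α β x = weighted α β x₀ := by
      funext t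
      unfold weighted
      congr 1
      exact Equiv.prod_comp (Tuple.sort x₀) fun j => |t - x₀ j|
    simp only [hF, this]
  refine ⟨x, F x, Tuple.monotone_sort x₀, ?_, hle x, fun y => ?_⟩
  · obtain ⟨t, ht, htx⟩ : ∃ t ∈ Ioo (0 : ℝ) 1, t ∉ range x :=
      (Ioo_infinite (zero_lt_one' ℝ)).exists_notMem_finite (finite_range x)
    refine lt_of_lt_of_le ?_ (hle x t ⟨ht.1.le, ht.2.le⟩)
    unfold weighted
    refine mul_pos (mul_pos (Real.rpow_pos_of_pos ht.1 _)
      (Real.rpow_pos_of_pos (sub_pos.2 ht.2) _)) (Finset.prod_pos fun j _ => abs_pos.2 ?_)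
    exact fun h => htx ⟨j, (sub_eq_zero.1 h).symm⟩
  · obtain ⟨t, ht, hte⟩ := hatt y
    exact ⟨t, ht, by rw [hFx, ← hte]; exact hmin' y⟩

/-- If every zero in `S` can be moved so that the weighted modulus decreases off `J`, and the
maximum is not attained on `J`, then the maximum can be decreased. -/
lemma exists_decrease {α β M : ℝ} (hα : 0 ≤ α) (hβ : 0 ≤ β) {n : ℕ} {x : Fin n → ℝ} (hM0 : 0 < M)
    (hM : ∀ t ∈ Icc (0 : ℝ) 1, weighted α β x t ≤ M) (y : ℝ → Fin n → ℝ) (hy : Continuous y)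
    (hy0 : y 0 = x) (S : Finset (Fin n)) (hS : ∀ δ, ∀ j ∉ S, y δ j = x j)
    (h : ∀ t ∈ Icc (0 : ℝ) 1, weighted α β x t < M ∨
      ∀ᶠ z : ℝ × ℝ in 𝓝 (0, t), 0 < z.1 → ∏ j ∈ S, |z.2 - y z.1 j| < ∏ j ∈ S, |z.2 - x j|) :
    ∃ y : Fin n → ℝ, ∀ t ∈ Icc (0 : ℝ) 1, weighted α β y t < M := by
  -- Each t has a neighbourhood that works for small δ > 0: by continuity where the value is below
  -- M, by the shrinking product elsewhere. Compactness of [0, 1] gives one δ for all t.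
  have key : ∀ᶠ δ : ℝ in 𝓝 0, ∀ s ∈ Icc (0 : ℝ) 1,
      (0 < δ → s ∈ Icc (0 : ℝ) 1 → weighted α β (y δ) s < M) := by
    apply isCompact_Icc.eventually_forall_of_forall_eventually
    intro t ht
    rcases h t ht with h | h
    · have hc : Continuous fun z : ℝ × ℝ => weighted α β (y z.1) z.2 :=
        (continuous_weighted hα hβ n).comp ((hy.comp continuous_fst).prodMk continuous_snd)
      have := hc.continuousAt.eventually_lt (x₀ := ((0 : ℝ), t)) (continuousAt_const (y := M))
        (by simpa [hy0] using h)
      exact this.mono fun z hz _ _ => hz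
    · exact h.mono fun z hz hδ hs => weighted_lt_of_prod_lt S (hS _) (hz hδ) hs (hM _ hs) hM0
  have key' : ∀ᶠ δ : ℝ in 𝓝[>] 0, _ := nhdsWithin_le_nhds key
  obtain ⟨δ, hδ, hδ0⟩ := (key'.and self_mem_nhdsWithin).exists
  exact ⟨y δ, fun t ht => hδ t ht hδ0 ht⟩

/-- The maximum is attained between any two neighbouring zeros. -/
lemma exists_eq_max {α β M : ℝ} (hα : 0 ≤ α) (hβ : 0 ≤ β) {n : ℕ} {x : Fin n → ℝ} (hx : Monotone x)
    (hM0 : 0 < M) (hM : ∀ t ∈ Icc (0 : ℝ) 1, weighted α β x t ≤ M)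
    (hmin : ∀ y : Fin n → ℝ, ∃ t ∈ Icc (0 : ℝ) 1, M ≤ weighted α β y t) (i : Fin (n + 1)) :
    ∃ ξ ∈ Icc (0 : ℝ) 1, (∀ j : Fin n, j.castSucc < i → x j ≤ ξ) ∧
      (∀ j : Fin n, i ≤ j.castSucc → ξ ≤ x j) ∧ weighted α β x ξ = M := by
  by_contra! hcon
  -- If the i-th gap misses the maximum, every point where M is attained lies strictly beyond one of
  -- the zeros bounding the gap. Widening the gap then lowers the maximum, against minimality.
  have hlt : ∀ t ∈ Icc (0 : ℝ) 1, weighted α β x t < M ∨ (∃ j : Fin n, j.castSucc < i ∧ t < x j) ∨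
      ∃ j : Fin n, i ≤ j.castSucc ∧ x j < t := by
    intro t ht
    by_contra! h
    exact hcon t ht h.2.1 h.2.2 (le_antisymm (hM t ht) h.1)
  suffices ∃ y : Fin n → ℝ, ∀ t ∈ Icc (0 : ℝ) 1, weighted α β y t < M by
    obtain ⟨y, hy⟩ := this
    obtain ⟨t, ht, hMt⟩ := hmin y
    exact (hy t ht).not_ge hMt
  have ev : ∀ (f : ℝ × ℝ → ℝ), Continuous f → ∀ t : ℝ, 0 < f (0, t) →
      ∀ᶠ z in 𝓝 ((0 : ℝ), t), 0 < f z := fun f hf t ht =>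
    (continuousAt_const (y := (0 : ℝ))).eventually_lt hf.continuousAt ht
  rcases Fin.eq_zero_or_eq_succ i with rfl | ⟨a, rfl⟩
  · rcases Nat.eq_zero_or_pos n with rfl | hn
    · refine ⟨x, fun t ht => ?_⟩
      rcases hlt t ht with h | ⟨j, -⟩ | ⟨j, -⟩
      · exact h
      · exact j.elim0
      · exact j.elim0
    -- The first gap is bounded by a zero on the right only, which is moved right; the last gap is
    -- treated symmetrically.
    · set a : Fin n := ⟨0, hn⟩
      refine exists_decrease hα hβ hM0 hM (fun δ => Function.update x a (x a + δ))
        (continuous_const.update a (by fun_prop)) (by simp) {a}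
        (fun δ j hj => Function.update_of_ne (by simpa using hj) _ _) fun t ht => ?_
      refine (hlt t ht).imp_right ?_
      rintro (⟨j, hj, -⟩ | ⟨j, -, hj⟩)
      · exact absurd hj (Fin.not_lt_zero _)
      · have hat : x a < t := (hx (Fin.mk_le_of_le_val (Nat.zero_le _))).trans_lt hj
        filter_upwards [ev (fun z => z.2 - x a - z.1) (by fun_prop) t (by simpa using hat)]
          with z hz hz0
        simp only [Finset.prod_singleton, Function.update_self]
        grind
  · by_cases hlast : a.succ = Fin.last n
    · refine exists_decrease hα hβ hM0 hM (fun δ => Function.update x a (x a - δ))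
        (continuous_const.update a (by fun_prop)) (by simp) {a}
        (fun δ j hj => Function.update_of_ne (by simpa using hj) _ _) fun t ht => ?_
      refine (hlt t ht).imp_right ?_
      rintro (⟨j, hj, hjt⟩ | ⟨j, hj, -⟩)
      · have hat : t < x a := hjt.trans_le (hx (Fin.castSucc_lt_succ_iff.1 hj))
        filter_upwards [ev (fun z => x a - z.1 - z.2) (by fun_prop) t (by simpa using hat)]
          with z hz hz0
        simp only [Finset.prod_singleton, Function.update_self]
        grind
      · rw [hlast] at hj
        exact absurd hj (not_le.2 (Fin.castSucc_lt_last j))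
    · obtain ⟨b, hb⟩ : ∃ b : Fin n, b.castSucc = a.succ :=
        -- For an interior gap between x a ≤ x b both zeros move apart by δ. Outside the widened gap
        -- the product of the two distances drops by δ(x b - x a) + δ², which is positive even if
        -- the zeros coincide.
        ⟨a.succ.castPred hlast, Fin.castSucc_castPred _ _⟩
      have hval : b.val = a.val + 1 := by simpa using congrArg Fin.val hb
      have hab : a ≠ b := by rintro rfl; omega
      have hxab : x a ≤ x b := hx (Fin.le_def.2 (by omega))
      refine exists_decrease hα hβ hM0 hM
        (fun δ => Function.update (Function.update x a (x a - δ)) b (x b + δ))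
        ((continuous_const.update a (by fun_prop)).update b (by fun_prop)) (by simp) {a, b}
        (fun δ j hj => by
          simp only [Finset.mem_insert, Finset.mem_singleton, not_or] at hj
          rw [Function.update_of_ne hj.2, Function.update_of_ne hj.1]) fun t ht => ?_
      refine (hlt t ht).imp_right ?_
      rintro (⟨j, hj, hjt⟩ | ⟨j, hj, hjt⟩)
      · have hat : t < x a := hjt.trans_le (hx (Fin.castSucc_lt_succ_iff.1 hj))
        filter_upwards [ev (fun z => x a - z.1 - z.2) (by fun_prop) t (by simpa using hat)]
          with z hz hz0
        rw [Finset.prod_pair hab, Finset.prod_pair hab, Function.update_self,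
          Function.update_of_ne hab, Function.update_self, abs_of_nonpos, abs_of_nonpos,
          abs_of_nonpos, abs_of_nonpos]
        · nlinarith
        all_goals linarith
      · have hbj : b ≤ j := by
          rw [← hb] at hj
          exact Fin.castSucc_le_castSucc_iff.1 hj
        have hat : x b < t := (hx hbj).trans_lt hjt
        filter_upwards [ev (fun z => z.2 - x b - z.1) (by fun_prop) t (by simpa using hat)]
          with z hz hz0
        rw [Finset.prod_pair hab, Finset.prod_pair hab, Function.update_self,
          Function.update_of_ne hab, Function.update_self, abs_of_nonneg, abs_of_nonneg,
          abs_of_nonneg, abs_of_nonneg]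
        · nlinarith
        all_goals linarith

/-- The zeros `x` and the alternation points `ξ` of a weighted Chebyshev polynomial on `[0, 1]`
with maximum `M`. -/
structure IsChebyshev (α β : ℝ) {n : ℕ} (x : Fin n → ℝ) (ξ : Fin (n + 1) → ℝ) (M : ℝ) : Prop where
  pos : 0 < M
  le : ∀ t ∈ Icc (0 : ℝ) 1, weighted α β x t ≤ M
  mem : ∀ i, ξ i ∈ Icc (0 : ℝ) 1
  eq : ∀ i, weighted α β x (ξ i) = M
  lt_zero : ∀ i j, i ≤ Fin.castSucc j → ξ i < x j
  zero_lt : ∀ i j, Fin.castSucc j < i → x j < ξ i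

/-- The weighted modulus is M > 0 at the chosen points and 0 at the zeros, which makes the
interlacing strict and hence the zeros simple. -/
theorem exists_isChebyshev {α β : ℝ} (hα : 0 ≤ α) (hβ : 0 ≤ β) (n : ℕ) :
    ∃ (x : Fin n → ℝ) (ξ : Fin (n + 1) → ℝ) (M : ℝ), IsChebyshev α β x ξ M := by
  obtain ⟨x, M, hx, hM0, hM, hmin⟩ := exists_min_sup hα hβ n
  choose ξ hξ hl hr he using exists_eq_max hα hβ hx hM0 hM hmin
  have hne : ∀ i j, ξ i ≠ x j := by
    intro i j h
    have := he i
    rw [weighted, Finset.prod_eq_zero (Finset.mem_univ j) (by rw [h, sub_self, abs_zero]),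
      mul_zero] at this
    exact hM0.ne this
  exact ⟨x, ξ, M, hM0, hM, hξ, he, fun i j h => (hr i j h).lt_of_ne (hne i j),
    fun i j h => (hl i j h).lt_of_ne (hne i j).symm⟩

namespace IsChebyshev

variable {α β M : ℝ} {n : ℕ} {x : Fin n → ℝ} {ξ : Fin (n + 1) → ℝ}

lemma zero_pos (h : IsChebyshev α β x ξ M) (j : Fin n) : 0 < x j :=
  (h.mem 0).1.trans_lt (h.lt_zero 0 j (Fin.zero_le _))

lemma zero_lt_one (h : IsChebyshev α β x ξ M) (j : Fin n) : x j < 1 :=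
  (h.zero_lt (Fin.last n) j (Fin.castSucc_lt_last j)).trans_le (h.mem _).2

lemma strictMono (h : IsChebyshev α β x ξ M) : StrictMono x := fun i j hij =>
  (h.zero_lt j.castSucc i (Fin.castSucc_lt_castSucc_iff.2 hij)).trans (h.lt_zero _ _ le_rfl)

lemma strictMono_points (h : IsChebyshev α β x ξ M) : StrictMono ξ :=
  Fin.strictMono_iff_lt_succ.2 fun i =>
    (h.lt_zero _ i le_rfl).trans (h.zero_lt _ i Fin.castSucc_lt_succ)

lemma weight_pos (h : IsChebyshev α β x ξ M) (i : Fin (n + 1)) :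
    0 < (ξ i) ^ α * (1 - ξ i) ^ β := by
  refine (weight_nonneg α β (h.mem i)).lt_of_ne fun h0 => ?_
  have := h.eq i
  rw [weighted, ← h0, zero_mul] at this
  exact h.pos.ne this

/-- A monic polynomial of degree `n` has weighted maximum at least `M`. -/
lemma le_of_monic (h : IsChebyshev α β x ξ M) {q : Polynomial ℂ} (hdeg : q.degree < (n + 1 : ℕ))
    (hq : ‖q.coeff n‖ = 1) {K : ℝ}
    (hK : ∀ i, (ξ i) ^ α * (1 - ξ i) ^ β * ‖q.eval ((ξ i : ℝ) : ℂ)‖ ≤ K) : M ≤ K := by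
  set D : Fin (n + 1) → ℝ := fun i => ∏ j ∈ Finset.univ.erase i, (ξ i - ξ j) with hD
  have hD' : ∀ i, D i = ∏ j : Fin n, (ξ i - ξ (i.succAbove j)) := by
    intro i
    rw [hD]
    simp only
    rw [← Finset.prod_image (s := Finset.univ) (g := i.succAbove) (f := fun j => ξ i - ξ j)
      (Fin.succAbove_right_injective.injOn)]
    congr 1
    ext j
    simp [Finset.mem_erase, eq_comm]
  -- By interlacing, the factors of the polynomial and of the Lagrange denominator at ξ i pair off
  -- with equal signs. Hence every term in the interpolation formula for the leading coefficient is
  -- positive, and nothing is lost on taking absolute values.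
  have hpos : ∀ i, 0 < (∏ j : Fin n, (ξ i - x j)) * D i := by
    intro i
    rw [hD', ← Finset.prod_mul_distrib]
    refine Finset.prod_pos fun j _ => ?_
    rcases lt_or_ge j.castSucc i with hji | hji
    · rw [Fin.succAbove_of_castSucc_lt _ _ hji]
      exact mul_pos (sub_pos.2 (h.zero_lt _ _ hji)) (sub_pos.2 (h.strictMono_points hji))
    · rw [Fin.succAbove_of_le_castSucc _ _ hji]
      exact mul_pos_of_neg_of_neg (sub_neg.2 (h.lt_zero _ _ hji))
        (sub_neg.2 (h.strictMono_points (hji.trans_lt Fin.castSucc_lt_succ)))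
  have hDne : ∀ i, D i ≠ 0 := fun i h0 => by simpa [h0] using hpos i
  -- the weighted Chebyshev polynomial itself
  have hT : ∑ i, M / (((ξ i) ^ α * (1 - ξ i) ^ β) * |D i|) = 1 := by
    have h1 := Lagrange.coeff_eq_sum (s := Finset.univ) (v := ξ)
      (P := ∏ j : Fin n, (Polynomial.X - Polynomial.C (x j))) h.strictMono_points.injective.injOn
      (by rw [Polynomial.degree_prod_of_monic _ _ fun j _ => Polynomial.monic_X_sub_C _]
          simp only [Polynomial.degree_X_sub_C]
          simp
          exact_mod_cast Nat.lt_succ_self n)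
    have hm : (∏ j : Fin n, (Polynomial.X - Polynomial.C (x j))).coeff n = 1 := by
      have hmon := Polynomial.monic_prod_of_monic Finset.univ
        (fun j : Fin n => Polynomial.X - Polynomial.C (x j)) fun j _ => Polynomial.monic_X_sub_C _
      have hnd : (∏ j : Fin n, (Polynomial.X - Polynomial.C (x j))).natDegree = n := by
        rw [Polynomial.natDegree_prod_of_monic _ _ fun j _ => Polynomial.monic_X_sub_C _]
        simp
      rw [Polynomial.Monic, Polynomial.leadingCoeff, hnd] at hmon
      exact hmon
    rw [Finset.card_univ, Fintype.card_fin, Nat.add_sub_cancel, hm] at h1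
    refine (Finset.sum_congr rfl fun i _ => ?_).trans h1.symm
    have hw := h.weight_pos i
    rw [Polynomial.eval_prod]
    simp only [Polynomial.eval_sub, Polynomial.eval_X, Polynomial.eval_C]
    have he := h.eq i
    rw [weighted, ← Finset.abs_prod] at he
    have hq' : (∏ j : Fin n, (ξ i - x j)) / D i = |∏ j : Fin n, (ξ i - x j)| / |D i| := by
      rw [← abs_div, abs_of_pos]
      exact div_pos_iff.2 (mul_pos_iff.1 (hpos i))
    change _ = (∏ j : Fin n, (ξ i - x j)) / D i
    rw [hq', ← he, mul_div_mul_left _ _ hw.ne']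
  -- The same formula for q, estimated by the triangle inequality. The two sums differ only in the
  -- factors M and K.
  have hQ : 1 ≤ ∑ i, K / (((ξ i) ^ α * (1 - ξ i) ^ β) * |D i|) := by
    have h1 := Lagrange.coeff_eq_sum (s := Finset.univ) (v := fun i => ((ξ i : ℝ) : ℂ)) (P := q)
      (fun i _ j _ hij => h.strictMono_points.injective (Complex.ofReal_injective hij))
      (by simpa using hdeg)
    rw [Finset.card_univ, Fintype.card_fin, Nat.add_sub_cancel] at h1
    rw [h1] at hq
    refine hq.ge.trans ((norm_sum_le _ _).trans (Finset.sum_le_sum fun i _ => ?_))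
    have hw := h.weight_pos i
    have hDn : ‖∏ j ∈ Finset.univ.erase i, (((ξ i : ℝ) : ℂ) - ((ξ j : ℝ) : ℂ))‖ = |D i| := by
      rw [← Real.norm_eq_abs, ← Complex.norm_real, hD]
      push_cast
      rfl
    rw [norm_div, hDn, ← div_div]
    refine div_le_div_of_nonneg_right ?_ (abs_nonneg _)
    rw [le_div_iff₀ hw, mul_comm]
    exact hK i
  have hc : 0 < ∑ i, 1 / (((ξ i) ^ α * (1 - ξ i) ^ β) * |D i|) :=
    Finset.sum_pos (fun i _ => one_div_pos.2 (mul_pos (h.weight_pos i) (abs_pos.2 (hDne i))))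
      Finset.univ_nonempty
  have e : ∀ A : ℝ, ∑ i, A / (((ξ i) ^ α * (1 - ξ i) ^ β) * |D i|)
      = A * ∑ i, 1 / (((ξ i) ^ α * (1 - ξ i) ^ β) * |D i|) := fun A => by
    rw [Finset.mul_sum]
    exact Finset.sum_congr rfl fun i _ => by rw [mul_one_div]
  rw [e] at hT hQ
  exact le_of_mul_le_mul_right (hT.trans_le hQ) hc

end IsChebyshev

end Extremal

section Ball

open Filter Topology Set

/-! ### The upper bound on the ball -/

section Triangle

variable {α β M : ℝ} {l₁ l₂ : ℕ} {x : Fin (l₁ + l₂) → ℝ} {ξ : Fin (l₁ + l₂ + 1) → ℝ}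

/-- The factor of the extremal polynomial that depends on the first variable. -/
def firstFactor (α : ℝ) (x : Fin (l₁ + l₂) → ℝ) (t : ℝ) : ℝ :=
  t ^ α * ∏ j : Fin l₁, |t - x (Fin.castAdd l₂ j)|

/-- The factor of the extremal polynomial that depends on the second variable. -/
def secondFactor (β : ℝ) (x : Fin (l₁ + l₂) → ℝ) (t : ℝ) : ℝ :=
  t ^ β * ∏ j : Fin l₂, |t - (1 - x (Fin.natAdd l₁ j))|

lemma firstFactor_mul_secondFactor (t : ℝ) :
    firstFactor α x t * secondFactor β x (1 - t) = weighted α β x t := by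
  rw [firstFactor, secondFactor, weighted, Fin.prod_univ_add]
  have : ∏ j : Fin l₂, |1 - t - (1 - x (Fin.natAdd l₁ j))| = ∏ j : Fin l₂, |t - x (Fin.natAdd l₁ j)| :=
    Finset.prod_congr rfl fun j _ => by rw [abs_sub_comm t]; congr 1; ring
  rw [this]
  ring

lemma firstFactor_nonneg {t : ℝ} (ht : 0 ≤ t) : 0 ≤ firstFactor α x t :=
  mul_nonneg (Real.rpow_nonneg ht _) (Finset.prod_nonneg fun _ _ => abs_nonneg _)

lemma secondFactor_nonneg {t : ℝ} (ht : 0 ≤ t) : 0 ≤ secondFactor β x t :=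
  mul_nonneg (Real.rpow_nonneg ht _) (Finset.prod_nonneg fun _ _ => abs_nonneg _)

lemma firstFactor_mono (hα : 0 ≤ α) {s t : ℝ} (hs : 0 ≤ s) (hst : s ≤ t)
    (h : ∀ j : Fin l₁, x (Fin.castAdd l₂ j) ≤ s) : firstFactor α x s ≤ firstFactor α x t := by
  refine mul_le_mul (Real.rpow_le_rpow hs hst hα) ?_ (Finset.prod_nonneg fun _ _ => abs_nonneg _)
    (Real.rpow_nonneg (hs.trans hst) _)
  refine Finset.prod_le_prod (fun _ _ => abs_nonneg _) fun j _ => ?_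
  rw [abs_of_nonneg (sub_nonneg.2 (h j)), abs_of_nonneg (sub_nonneg.2 ((h j).trans hst))]
  linarith

lemma secondFactor_mono (hβ : 0 ≤ β) {s t : ℝ} (hs : 0 ≤ s) (hst : s ≤ t)
    (h : ∀ j : Fin l₂, 1 - x (Fin.natAdd l₁ j) ≤ s) : secondFactor β x s ≤ secondFactor β x t := by
  refine mul_le_mul (Real.rpow_le_rpow hs hst hβ) ?_ (Finset.prod_nonneg fun _ _ => abs_nonneg _)
    (Real.rpow_nonneg (hs.trans hst) _)
  refine Finset.prod_le_prod (fun _ _ => abs_nonneg _) fun j _ => ?_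
  rw [abs_of_nonneg (sub_nonneg.2 (h j)), abs_of_nonneg (sub_nonneg.2 ((h j).trans hst))]
  linarith

/-- On s + t = 1 the product is the weighted modulus. If s lies beyond all zeros of the first
factor, that factor grows as s is raised to 1 - t; likewise for t. Otherwise the alternation point ξ
between the two groups of zeros satisfies s < ξ < 1 - t. As the second factor is at least as large
at 1 - s as at 1 - ξ, and f(s) g(1 - s) ≤ M = f(ξ) g(1 - ξ), it follows that f(s) ≤ f(ξ).
Symmetrically g(t) ≤ g(1 - ξ), and the product of these bounds is M. -/
lemma IsChebyshev.factors_le (h : IsChebyshev α β x ξ M) (hα : 0 ≤ α) (hβ : 0 ≤ β) {s t : ℝ}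
    (hs : 0 ≤ s) (ht : 0 ≤ t) (hst : s + t ≤ 1) :
    firstFactor α x s * secondFactor β x t ≤ M := by
  have hw : ∀ u ∈ Icc (0 : ℝ) 1, firstFactor α x u * secondFactor β x (1 - u) ≤ M := fun u hu => by
    rw [firstFactor_mul_secondFactor]; exact h.le u hu
  have ht' := hw (1 - t) ⟨by linarith, by linarith⟩
  rw [sub_sub_cancel] at ht'
  have hs' := hw s ⟨hs, by linarith⟩
  by_cases hA : ∀ j : Fin l₁, x (Fin.castAdd l₂ j) ≤ s
  · exact (mul_le_mul_of_nonneg_right (firstFactor_mono hα hs (by linarith) hA)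
      (secondFactor_nonneg ht)).trans ht'
  by_cases hB : ∀ j : Fin l₂, 1 - x (Fin.natAdd l₁ j) ≤ t
  · exact (mul_le_mul_of_nonneg_left (secondFactor_mono hβ ht (by linarith) hB)
      (firstFactor_nonneg hs)).trans hs'
  push Not at hA hB
  obtain ⟨j₁, hj₁⟩ := hA
  obtain ⟨j₂, hj₂⟩ := hB
  -- The alternation point with index l₁ has exactly l₁ zeros below it, those of the first factor.
  set i : Fin (l₁ + l₂ + 1) := ⟨l₁, by omega⟩ with hi
  have hξ₁ : ∀ j : Fin l₁, x (Fin.castAdd l₂ j) < ξ i := fun j =>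
    h.zero_lt _ _ (Fin.lt_def.2 (by simp [hi]))
  have hξ₂ : ∀ j : Fin l₂, ξ i < x (Fin.natAdd l₁ j) := fun j =>
    h.lt_zero _ _ (Fin.le_def.2 (by simp [hi]))
  have hξ0 := (h.mem i).1
  have hξ1 := (h.mem i).2
  have he : firstFactor α x (ξ i) * secondFactor β x (1 - ξ i) = M := by
    rw [firstFactor_mul_secondFactor, h.eq]
  have hf0 := firstFactor_nonneg (α := α) (x := x) hξ0
  have hg0 := secondFactor_nonneg (β := β) (x := x) (sub_nonneg.2 hξ1)
  have hf : 0 < firstFactor α x (ξ i) := hf0.lt_of_ne fun h0 => by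
    rw [← h0, zero_mul] at he; exact h.pos.ne he
  have hg : 0 < secondFactor β x (1 - ξ i) := hg0.lt_of_ne fun h0 => by
    rw [← h0, mul_zero] at he; exact h.pos.ne he
  have h1 : firstFactor α x s ≤ firstFactor α x (ξ i) := by
    have h3 : secondFactor β x (1 - ξ i) ≤ secondFactor β x (1 - s) :=
      secondFactor_mono hβ (by linarith) (by linarith [hξ₁ j₁]) fun j => by linarith [hξ₂ j]
    refine le_of_mul_le_mul_right ?_ hg
    rw [he]
    exact (mul_le_mul_of_nonneg_left h3 (firstFactor_nonneg hs)).trans hs'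
  have h2 : secondFactor β x t ≤ secondFactor β x (1 - ξ i) := by
    have h3 : firstFactor α x (ξ i) ≤ firstFactor α x (1 - t) :=
      firstFactor_mono hα hξ0 (by linarith [hξ₂ j₂]) fun j => (hξ₁ j).le
    refine le_of_mul_le_mul_left ?_ hf
    rw [he]
    exact (mul_le_mul_of_nonneg_right h3 (secondFactor_nonneg ht)).trans ht'
  rw [← he]
  exact mul_le_mul h1 h2 (secondFactor_nonneg ht) hf0

end Triangle

/-! ### The uniform norm on the ball -/

lemma isCompact_ball : IsCompact ball := by
  refine Metric.isCompact_of_isClosed_isBounded ?_ ?_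
  · exact isClosed_le (by fun_prop) continuous_const
  · refine (Metric.isBounded_closedBall (x := (0 : ℂ × ℂ)) (r := 1)).subset fun z hz => ?_
    have hz' : ‖z.1‖ ^ 2 + ‖z.2‖ ^ 2 ≤ 1 := hz
    rw [mem_closedBall_zero_iff, Prod.norm_def]
    refine max_le ?_ ?_
    · nlinarith [norm_nonneg z.1, sq_nonneg ‖z.2‖]
    · nlinarith [norm_nonneg z.2, sq_nonneg ‖z.1‖]

lemma continuous_value (P : MvPolynomial (Fin 4) ℂ) : Continuous (value P) := by
  unfold value
  refine (MvPolynomial.continuous_eval P).comp (continuous_pi fun i => ?_)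
  fin_cases i
  · exact continuous_fst
  · exact Complex.continuous_conj.comp continuous_fst
  · exact continuous_snd
  · exact Complex.continuous_conj.comp continuous_snd

lemma norm_value_le_supNorm (P : MvPolynomial (Fin 4) ℂ) {z : ℂ × ℂ} (hz : z ∈ ball) :
    ‖value P z‖ ≤ supNorm P := by
  have hb := isCompact_ball.bddAbove_image (continuous_value P).norm.continuousOn
  refine le_ciSup (f := fun z : ball => ‖value P z‖) ?_ ⟨z, hz⟩
  refine hb.mono ?_
  rintro _ ⟨w, rfl⟩
  exact ⟨w, w.2, rfl⟩

lemma supNorm_le {P : MvPolynomial (Fin 4) ℂ} {K : ℝ} (h : ∀ z ∈ ball, ‖value P z‖ ≤ K) :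
    supNorm P ≤ K := by
  have : Nonempty ball := ⟨⟨0, by simp [ball]⟩⟩
  exact ciSup_le fun z => h z z.2

/-! ### The extremal polynomial -/

/-- The top-degree parts cancel, by telescoping: (Z - c)A - ZB = Z(A - B) - cA. An empty product is
excluded because the bound would read 0 < 0. -/
lemma totalDegree_prod_sub_C_sub_prod_lt {ι σ : Type*} (Z : ι → MvPolynomial σ ℂ)
    (hZ : ∀ j, (Z j).totalDegree ≤ 2) (c : ι → ℂ) {s : Finset ι} (hs : s.Nonempty) :
    (∏ j ∈ s, (Z j - MvPolynomial.C (c j)) - ∏ j ∈ s, Z j).totalDegree < 2 * s.card := by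
  have hdeg : ∀ j, (Z j - MvPolynomial.C (c j)).totalDegree ≤ 2 := fun j =>
    (MvPolynomial.totalDegree_sub_C_le _ _).trans (hZ j)
  induction hs using Finset.Nonempty.cons_induction with
  | singleton j => simp
  | cons j s hj hs ih =>
    rw [Finset.prod_cons, Finset.prod_cons, Finset.card_cons]
    set A := ∏ j ∈ s, (Z j - MvPolynomial.C (c j))
    set B := ∏ j ∈ s, Z j
    have hA : A.totalDegree ≤ 2 * s.card := by
      refine (MvPolynomial.totalDegree_finsetProd _ _).trans ?_
      refine (Finset.sum_le_card_nsmul _ _ 2 fun j _ => hdeg j).trans ?_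
      simp [mul_comm]
    have e : (Z j - MvPolynomial.C (c j)) * A - Z j * B = Z j * (A - B) - MvPolynomial.C (c j) * A := by
      ring
    rw [e]
    refine (MvPolynomial.totalDegree_sub _ _).trans_lt (max_lt ?_ ?_)
    · refine (MvPolynomial.totalDegree_mul _ _).trans_lt ?_
      have := hZ j
      omega
    · refine (MvPolynomial.totalDegree_mul _ _).trans_lt ?_
      rw [MvPolynomial.totalDegree_C]
      omega

section Extremal

variable {l₁ l₂ : ℕ}

/-- The squared modulus of the variable that carries the `j`-th zero. -/
def zeroVar (j : Fin (l₁ + l₂)) : MvPolynomial (Fin 4) ℂ :=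
  Fin.addCases (fun _ => MvPolynomial.X 0 * MvPolynomial.X 1)
    (fun _ => MvPolynomial.X 2 * MvPolynomial.X 3) j

/-- The value that the squared modulus takes at the `j`-th zero. -/
def zeroVal (x : Fin (l₁ + l₂) → ℝ) (j : Fin (l₁ + l₂)) : ℂ :=
  Fin.addCases (fun i => ((x (Fin.castAdd l₂ i) : ℝ) : ℂ))
    (fun i => ((1 - x (Fin.natAdd l₁ i) : ℝ) : ℂ)) j

/-- The polynomial of least deviation on the ball. -/
def extremal (a b : ℕ) (x : Fin (l₁ + l₂) → ℝ) : MvPolynomial (Fin 4) ℂ :=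
  MvPolynomial.X 0 ^ a * MvPolynomial.X 2 ^ b * ∏ j, (zeroVar j - MvPolynomial.C (zeroVal x j))

lemma totalDegree_zeroVar_le (j : Fin (l₁ + l₂)) : (zeroVar j).totalDegree ≤ 2 := by
  unfold zeroVar
  refine Fin.addCases (fun i => ?_) (fun i => ?_) j <;>
  · simp only [Fin.addCases_left, Fin.addCases_right]
    refine (MvPolynomial.totalDegree_mul _ _).trans ?_
    simp

lemma mono_eq_mul_prod (a b : ℕ) :
    mono (l₁ + a) l₁ (l₂ + b) l₂ =
      MvPolynomial.X 0 ^ a * MvPolynomial.X 2 ^ b * ∏ j : Fin (l₁ + l₂), zeroVar j := by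
  rw [Fin.prod_univ_add]
  simp only [zeroVar, Fin.addCases_left, Fin.addCases_right, Finset.prod_const, Finset.card_univ,
    Fintype.card_fin]
  rw [mono]
  ring

lemma totalDegree_mono_sub_extremal_lt (a b : ℕ) (x : Fin (l₁ + l₂) → ℝ)
    (hN : 0 < (l₁ + a) + l₁ + (l₂ + b) + l₂) :
    (mono (l₁ + a) l₁ (l₂ + b) l₂ - extremal a b x).totalDegree
      < (l₁ + a) + l₁ + (l₂ + b) + l₂ := by
  rw [← MvPolynomial.totalDegree_neg, neg_sub, mono_eq_mul_prod, extremal, ← mul_sub]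
  rcases Nat.eq_zero_or_pos (l₁ + l₂) with hn | hn
  · have : IsEmpty (Fin (l₁ + l₂)) := by rw [hn]; infer_instance
    simpa using hN
  · have hne : (Finset.univ : Finset (Fin (l₁ + l₂))).Nonempty := ⟨⟨0, hn⟩, Finset.mem_univ _⟩
    have h1 := totalDegree_prod_sub_C_sub_prod_lt zeroVar totalDegree_zeroVar_le (zeroVal x) hne
    rw [Finset.card_univ, Fintype.card_fin] at h1
    refine (MvPolynomial.totalDegree_mul _ _).trans_lt ?_
    have h2 : (MvPolynomial.X 0 ^ a * MvPolynomial.X 2 ^ b : MvPolynomial (Fin 4) ℂ).totalDegree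
        ≤ a + b := by
      refine (MvPolynomial.totalDegree_mul _ _).trans ?_
      simp
    omega

lemma sqrt_pow_eq_rpow {t : ℝ} (ht : 0 ≤ t) (a : ℕ) : √t ^ a = t ^ ((a : ℝ) / 2) := by
  rw [Real.rpow_div_two_eq_sqrt _ ht, Real.rpow_natCast]

/-- Half-integer exponents enter here: |z₁|^a is the power a/2 of |z₁|², the variable carrying the
zeros. -/
lemma norm_value_extremal (a b : ℕ) (x : Fin (l₁ + l₂) → ℝ) (z : ℂ × ℂ) :
    ‖value (extremal a b x) z‖ =
      firstFactor (a / 2) x (‖z.1‖ ^ 2) * secondFactor (b / 2) x (‖z.2‖ ^ 2) := by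
  have e1 : ∀ (w : ℂ) (c : ℝ), ‖w * (starRingEnd ℂ) w - c‖ = |‖w‖ ^ 2 - c| := fun w c => by
    rw [Complex.mul_conj, Complex.normSq_eq_norm_sq, ← Complex.ofReal_sub, Complex.norm_real,
      Real.norm_eq_abs]
  rw [value, extremal, map_mul, map_mul, map_prod, Fin.prod_univ_add, firstFactor, secondFactor,
    ← sqrt_pow_eq_rpow (sq_nonneg _), ← sqrt_pow_eq_rpow (sq_nonneg _),
    Real.sqrt_sq (norm_nonneg _), Real.sqrt_sq (norm_nonneg _)]
  simp only [zeroVar, zeroVal, Fin.addCases_left, Fin.addCases_right, map_sub, map_mul, map_pow,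
    MvPolynomial.eval_X, MvPolynomial.eval_C, norm_mul, norm_pow, norm_prod, Matrix.cons_val]
  simp only [e1]
  ring

end Extremal

lemma minDeviation_le {M : ℝ} {l₁ l₂ a b : ℕ} {x : Fin (l₁ + l₂) → ℝ}
    {ξ : Fin (l₁ + l₂ + 1) → ℝ} (h : IsChebyshev (a / 2) (b / 2) x ξ M)
    (hN : 0 < (l₁ + a) + l₁ + (l₂ + b) + l₂) :
    minDeviation (l₁ + a) l₁ (l₂ + b) l₂ ≤ M := by
  refine (ciInf_le (f := fun P : {P : MvPolynomial (Fin 4) ℂ //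
      P.totalDegree < (l₁ + a) + l₁ + (l₂ + b) + l₂} =>
    supNorm (mono (l₁ + a) l₁ (l₂ + b) l₂ - P.1)) ⟨0, ?_⟩
    ⟨_, totalDegree_mono_sub_extremal_lt a b x hN⟩).trans ?_
  · rintro _ ⟨P, rfl⟩
    exact Real.iSup_nonneg fun _ => norm_nonneg _
  · simp only [sub_sub_cancel]
    refine supNorm_le fun z hz => ?_
    rw [norm_value_extremal]
    exact h.factors_le (by positivity) (by positivity) (sq_nonneg _) (sq_nonneg _) hz

/-! ### The lower bound: averaging over the torus -/

/-- The part of a polynomial of weight `(a, b)` for the torus action, divided by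
`z₁ ^ a z₂ ^ b` and restricted to the unit sphere. -/
def torusPart (a b : ℕ) : MvPolynomial (Fin 4) ℂ →ₗ[ℂ] Polynomial ℂ :=
  (MvPolynomial.basisMonomials (Fin 4) ℂ).constr ℂ fun d =>
    if d 0 = d 1 + a ∧ d 2 = d 3 + b then
      Polynomial.X ^ d 1 * (1 - Polynomial.X) ^ d 3 else 0

lemma torusPart_monomial (a b : ℕ) (d : Fin 4 →₀ ℕ) (c : ℂ) :
    torusPart a b (MvPolynomial.monomial d c) = c • if d 0 = d 1 + a ∧ d 2 = d 3 + b then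
      Polynomial.X ^ d 1 * (1 - Polynomial.X) ^ d 3 else 0 := by
  have : MvPolynomial.monomial d c = c • MvPolynomial.basisMonomials (Fin 4) ℂ d := by
    simp [MvPolynomial.smul_monomial]
  rw [this, map_smul, torusPart, Module.Basis.constr_basis]

lemma sum_le_totalDegree {P : MvPolynomial (Fin 4) ℂ} {d : Fin 4 →₀ ℕ} (hd : d ∈ P.support) :
    d 0 + d 1 + d 2 + d 3 ≤ P.totalDegree := by
  have := MvPolynomial.le_totalDegree hd
  rwa [Finsupp.sum_fintype _ _ (fun _ => rfl), Fin.sum_univ_four] at this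

lemma one_sub_X_pow_eq (k : ℕ) : (1 - Polynomial.X : Polynomial ℂ) ^ k =
    Polynomial.C ((-1) ^ k) * (Polynomial.X - Polynomial.C 1) ^ k := by
  rw [Polynomial.C_pow, ← mul_pow]
  congr 1
  simp

lemma degree_X_pow_mul_one_sub_X_pow (k l : ℕ) :
    (Polynomial.X ^ k * (1 - Polynomial.X) ^ l : Polynomial ℂ).degree = (k + l : ℕ) := by
  rw [one_sub_X_pow_eq, Polynomial.degree_mul, Polynomial.degree_C_mul (by simp),
    Polynomial.degree_pow, Polynomial.degree_pow, Polynomial.degree_X_sub_C, Polynomial.degree_X]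
  simp

lemma norm_coeff_X_pow_mul_one_sub_X_pow (k l : ℕ) :
    ‖(Polynomial.X ^ k * (1 - Polynomial.X) ^ l : Polynomial ℂ).coeff (k + l)‖ = 1 := by
  rw [show k + l = (Polynomial.X ^ k * (1 - Polynomial.X) ^ l : Polynomial ℂ).natDegree from
    (Polynomial.natDegree_eq_of_degree_eq_some (degree_X_pow_mul_one_sub_X_pow k l)).symm,
    Polynomial.coeff_natDegree, one_sub_X_pow_eq, Polynomial.leadingCoeff_mul,
    Polynomial.leadingCoeff_mul, Polynomial.leadingCoeff_pow (Polynomial.X - Polynomial.C 1),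
    Polynomial.leadingCoeff_X_sub_C]
  simp

/-- A surviving monomial has total degree a + b + 2(d 1 + d 3), while its image has degree d 1 + d
3. -/
lemma degree_torusPart_lt {a b n : ℕ} {P : MvPolynomial (Fin 4) ℂ}
    (hP : P.totalDegree < a + b + 2 * n) : (torusPart a b P).degree < n := by
  rw [P.as_sum, map_sum, ← Polynomial.mem_degreeLT]
  refine Submodule.sum_mem _ fun d hd => ?_
  rw [torusPart_monomial]
  refine Submodule.smul_mem _ _ ?_
  split_ifs with hc
  · have := sum_le_totalDegree hd
    rw [Polynomial.mem_degreeLT, degree_X_pow_mul_one_sub_X_pow]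
    exact_mod_cast (by omega : d 1 + d 3 < n)
  · exact Submodule.zero_mem _

lemma mono_eq_monomial (k₁ k₂ l₁ l₂ : ℕ) : mono k₁ l₁ k₂ l₂ =
    MvPolynomial.monomial (Finsupp.equivFunOnFinite.symm ![k₁, l₁, k₂, l₂]) 1 := by
  rw [MvPolynomial.monomial_eq, Finsupp.prod_fintype _ _ (fun _ => pow_zero _),
    Fin.prod_univ_four, mono]
  simp

lemma torusPart_mono (a b l₁ l₂ : ℕ) : torusPart a b (mono (l₁ + a) l₁ (l₂ + b) l₂) =
    Polynomial.X ^ l₁ * (1 - Polynomial.X) ^ l₂ := by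
  rw [mono_eq_monomial, torusPart_monomial]
  simp

lemma value_monomial (d : Fin 4 →₀ ℕ) (c : ℂ) (z : ℂ × ℂ) :
    value (MvPolynomial.monomial d c) z = c * (z.1 ^ d 0 * starRingEnd ℂ z.1 ^ d 1 *
      z.2 ^ d 2 * starRingEnd ℂ z.2 ^ d 3) := by
  rw [value, MvPolynomial.eval_monomial, Finsupp.prod_fintype _ _ (fun _ => pow_zero _),
    Fin.prod_univ_four]
  simp

/-- Orthogonality of the characters, for bounded exponents. -/
lemma sum_char {m : ℕ} {ζ : ℂ} (hζ : IsPrimitiveRoot ζ m) (k l a : ℕ) (hk : k < m)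
    (hl : l + a < m) :
    ∑ p ∈ Finset.range m, (ζ ^ p) ^ k * (starRingEnd ℂ (ζ ^ p)) ^ l * (starRingEnd ℂ (ζ ^ p)) ^ a
      = if k = l + a then (m : ℂ) else 0 := by
  have hm0 : m ≠ 0 := by omega
  have hn : ‖ζ‖ = 1 := hζ.norm'_eq_one hm0
  have hconj : starRingEnd ℂ ζ = ζ⁻¹ := (Complex.inv_eq_conj hn).symm
  have hζ0 : ζ ≠ 0 := hζ.ne_zero hm0
  have e : ∀ p : ℕ, (ζ ^ p) ^ k * (starRingEnd ℂ (ζ ^ p)) ^ l * (starRingEnd ℂ (ζ ^ p)) ^ a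
      = (ζ ^ ((k : ℤ) - (l + a : ℕ))) ^ p := fun p => by
    rw [map_pow, hconj, mul_assoc, ← pow_add, zpow_sub₀ hζ0, zpow_natCast, zpow_natCast, div_pow,
      ← pow_mul, ← pow_mul, ← pow_mul, ← pow_mul, inv_pow, div_eq_mul_inv, mul_comm k p,
      mul_comm (l + a) p]
  simp only [e]
  split_ifs with h
  · simp [h]
  · have hne : ζ ^ ((k : ℤ) - (l + a : ℕ)) ≠ 1 := by
      intro h1
      have h2 := (hζ.zpow_eq_one_iff_dvd _).1 h1
      have h3 := Int.eq_zero_of_abs_lt_dvd h2 (by rw [abs_lt]; omega)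
      omega
    rw [geom_sum_eq hne, ← zpow_natCast, ← zpow_mul, mul_comm, zpow_mul, zpow_natCast,
      hζ.pow_eq_one, one_zpow, sub_self, zero_div]

/-- Averaging over m-th roots of unity in place of the whole torus: since m exceeds all exponents
involved, the finite character sums are already exact. A monomial of weight (a, b) contributes √t^(2
d 1 + a) √(1 - t)^(2 d 3 + b); all others cancel. -/
lemma sum_torus (a b m : ℕ) {ζ : ℂ} (hζ : IsPrimitiveRoot ζ m) (Q : MvPolynomial (Fin 4) ℂ)
    (hm : Q.totalDegree + a + b < m) {t : ℝ} (ht : t ∈ Icc (0 : ℝ) 1) :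
    ∑ p ∈ Finset.range m, ∑ q ∈ Finset.range m,
      value Q ((√t : ℝ) * ζ ^ p, (√(1 - t) : ℝ) * ζ ^ q) *
        ((starRingEnd ℂ (ζ ^ p)) ^ a * (starRingEnd ℂ (ζ ^ q)) ^ b) =
      (m : ℂ) * m * ((√t : ℝ) ^ a * (√(1 - t) : ℝ) ^ b * (torusPart a b Q).eval (t : ℂ)) := by
  have hsum : ∀ z, value Q z = ∑ d ∈ Q.support, value (MvPolynomial.monomial d (Q.coeff d)) z := by
    intro z
    conv_lhs => rw [value, Q.as_sum, map_sum]
    rfl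
  have hT : (torusPart a b Q).eval (t : ℂ) =
      ∑ d ∈ Q.support, (torusPart a b (MvPolynomial.monomial d (Q.coeff d))).eval (t : ℂ) := by
    conv_lhs => rw [Q.as_sum, map_sum, Polynomial.eval_finsetSum]
  simp only [hsum, Finset.sum_mul, hT, Finset.mul_sum]
  have hswap : ∀ g : ℕ → ℕ → (Fin 4 →₀ ℕ) → ℂ,
      ∑ p ∈ Finset.range m, ∑ q ∈ Finset.range m, ∑ d ∈ Q.support, g p q d =
      ∑ d ∈ Q.support, ∑ p ∈ Finset.range m, ∑ q ∈ Finset.range m, g p q d := fun g => by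
    rw [Finset.sum_comm]
    simp only [Finset.sum_comm (t := Q.support)]
    rw [Finset.sum_congr rfl fun d _ => Finset.sum_comm]
  rw [hswap]
  refine Finset.sum_congr rfl fun d hd => ?_
  have hdeg := sum_le_totalDegree hd
  have h1 := sum_char hζ (d 0) (d 1) a (by omega) (by omega)
  have h2 := sum_char hζ (d 2) (d 3) b (by omega) (by omega)
  have hst : ((√t : ℝ) : ℂ) ^ 2 = t := by rw [← Complex.ofReal_pow, Real.sq_sqrt ht.1]
  have hst' : ((√(1 - t) : ℝ) : ℂ) ^ 2 = 1 - t := by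
    rw [← Complex.ofReal_pow, Real.sq_sqrt (sub_nonneg.2 ht.2)]; push_cast; rfl
  have e : ∀ p q : ℕ, value (MvPolynomial.monomial d (Q.coeff d))
        ((√t : ℝ) * ζ ^ p, (√(1 - t) : ℝ) * ζ ^ q) *
        ((starRingEnd ℂ (ζ ^ p)) ^ a * (starRingEnd ℂ (ζ ^ q)) ^ b) =
      (Q.coeff d * (√t : ℝ) ^ (d 0 + d 1) * (√(1 - t) : ℝ) ^ (d 2 + d 3)) *
      (((ζ ^ p) ^ d 0 * (starRingEnd ℂ (ζ ^ p)) ^ d 1 * (starRingEnd ℂ (ζ ^ p)) ^ a) *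
      ((ζ ^ q) ^ d 2 * (starRingEnd ℂ (ζ ^ q)) ^ d 3 * (starRingEnd ℂ (ζ ^ q)) ^ b)) := by
    intro p q
    rw [value_monomial]
    simp only [map_mul, Complex.conj_ofReal]
    ring
  simp only [e, ← Finset.mul_sum]
  rw [← Finset.sum_mul, h1, h2, torusPart_monomial]
  by_cases hc : d 0 = d 1 + a ∧ d 2 = d 3 + b
  · rw [if_pos hc.1, if_pos hc.2, if_pos hc, hc.1, hc.2]
    simp only [Polynomial.eval_smul, Polynomial.eval_mul, Polynomial.eval_pow, Polynomial.eval_X,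
      Polynomial.eval_sub, Polynomial.eval_one, smul_eq_mul]
    rw [← hst', ← hst]
    ring
  · rw [if_neg hc]
    rcases not_and_or.1 hc with h | h
    · simp [h]
    · simp [h]

/-- All sample points lie on the unit sphere and the characters are unimodular, so the average is
bounded by the uniform norm. -/
lemma weight_mul_norm_torusPart_le (a b : ℕ) (Q : MvPolynomial (Fin 4) ℂ) {t : ℝ}
    (ht : t ∈ Icc (0 : ℝ) 1) :
    t ^ ((a : ℝ) / 2) * (1 - t) ^ ((b : ℝ) / 2) * ‖(torusPart a b Q).eval (t : ℂ)‖ ≤ supNorm Q := by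
  set m := Q.totalDegree + a + b + 1 with hm
  have hm0 : m ≠ 0 := by omega
  have hζ := Complex.isPrimitiveRoot_exp m hm0
  set ζ := Complex.exp (2 * Real.pi * Complex.I / m)
  have hn : ‖ζ‖ = 1 := hζ.norm'_eq_one hm0
  have h := sum_torus a b m hζ Q (by omega) ht
  have hle : ‖(m : ℂ) * m * ((√t : ℝ) ^ a * (√(1 - t) : ℝ) ^ b * (torusPart a b Q).eval (t : ℂ))‖
      ≤ (m : ℝ) * m * supNorm Q := by
    rw [← h]
    refine (norm_sum_le_of_le (n := fun _ => (m : ℝ) * supNorm Q) _ fun p _ => ?_).trans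
      (by simp [mul_assoc])
    refine (norm_sum_le_of_le (n := fun _ => supNorm Q) _ fun q _ => ?_).trans (by simp)
    rw [norm_mul, norm_mul, norm_pow, norm_pow, RCLike.norm_conj, RCLike.norm_conj, norm_pow,
      norm_pow, hn]
    simp only [one_pow, mul_one]
    refine norm_value_le_supNorm Q ?_
    simp [ball, hn, Real.sq_sqrt ht.1, Real.sq_sqrt (sub_nonneg.2 ht.2)]
  rw [norm_mul, norm_mul, norm_mul, norm_mul, norm_pow, norm_pow, Complex.norm_natCast,
    Complex.norm_real, Complex.norm_real, Real.norm_of_nonneg (Real.sqrt_nonneg _),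
    Real.norm_of_nonneg (Real.sqrt_nonneg _), sqrt_pow_eq_rpow ht.1,
    sqrt_pow_eq_rpow (sub_nonneg.2 ht.2)] at hle
  exact le_of_mul_le_mul_left hle (by positivity)

theorem minDeviation_eq {M : ℝ} {l₁ l₂ a b : ℕ} {x : Fin (l₁ + l₂) → ℝ}
    {ξ : Fin (l₁ + l₂ + 1) → ℝ} (h : IsChebyshev (a / 2) (b / 2) x ξ M)
    (hN : 0 < (l₁ + a) + l₁ + (l₂ + b) + l₂) :
    minDeviation (l₁ + a) l₁ (l₂ + b) l₂ = M := by
  refine le_antisymm (minDeviation_le h hN) ?_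
  have : Nonempty {P : MvPolynomial (Fin 4) ℂ //
      P.totalDegree < (l₁ + a) + l₁ + (l₂ + b) + l₂} := ⟨0, by simpa using hN⟩
  refine le_ciInf fun P => ?_
  -- The subtracted polynomial does not reach the coefficient of degree n after projection, so that
  -- coefficient comes from X^l₁ (1 - X)^l₂ and is ±1.
  have hP := degree_torusPart_lt (a := a) (b := b) (n := l₁ + l₂) (P := P.1) (by have := P.2; omega)
  refine h.le_of_monic (q := torusPart a b (mono (l₁ + a) l₁ (l₂ + b) l₂ - P.1)) ?_ ?_
    fun i => weight_mul_norm_torusPart_le a b _ (h.mem i)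
  · rw [map_sub, torusPart_mono]
    refine (Polynomial.degree_sub_le _ _).trans_lt (max_lt ?_ (hP.trans ?_))
    · rw [degree_X_pow_mul_one_sub_X_pow]
      exact_mod_cast Nat.lt_succ_self _
    · exact_mod_cast Nat.lt_succ_self _
  · rw [map_sub, torusPart_mono, Polynomial.coeff_sub, Polynomial.coeff_eq_zero_of_degree_lt hP,
      sub_zero, norm_coeff_X_pow_mul_one_sub_X_pow]

end Ball

section LogSum

open Filter Topology Set Complex

/-! ### Logarithmic potentials of point masses on the real axis -/

lemma arg_mem_Ioo_of_im_pos {z : ℂ} (hz : 0 < z.im) : arg z ∈ Ioo 0 Real.pi := by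
  refine ⟨(arg_nonneg_iff.2 hz.le).lt_of_ne fun h => ?_, (arg_le_pi z).lt_of_ne fun h => ?_⟩
  · exact hz.ne' (arg_eq_zero_iff.1 h.symm).2
  · exact hz.ne' (arg_eq_pi_iff.1 h).2

variable {ι : Type*} [Fintype ι]

/-- The complex logarithmic potential of the masses `m i` at the real points `p i`. -/
def logSum (m p : ι → ℝ) (z : ℂ) : ℂ := ∑ i, (m i : ℂ) * log (z - p i)

variable {m p : ι → ℝ}

lemma sub_ofReal_im (z : ℂ) (t : ℝ) : (z - t).im = z.im := by simp

lemma logSum_re (m p : ι → ℝ) (z : ℂ) : (logSum m p z).re = ∑ i, m i * Real.log ‖z - p i‖ := by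
  simp [logSum, log_re]

lemma logSum_im (m p : ι → ℝ) (z : ℂ) : (logSum m p z).im = ∑ i, m i * arg (z - p i) := by
  simp [logSum, log_im]

lemma hasDerivAt_logSum (m p : ι → ℝ) {z : ℂ} (hz : z ∈ upperHalf) :
    HasDerivAt (logSum m p) (∑ i, (m i : ℂ) * (z - p i)⁻¹) z := by
  have h : HasDerivAt (fun z : ℂ => ∑ i, (m i : ℂ) * log (z - p i))
      (∑ i, (m i : ℂ) * (z - p i)⁻¹) z := by
    refine HasDerivAt.fun_sum fun i _ => HasDerivAt.const_mul _ ?_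
    have hs : z - (p i : ℂ) ∈ slitPlane := Or.inr (by rw [sub_ofReal_im]; exact ne_of_gt hz)
    have := ((hasDerivAt_id z).sub_const (p i : ℂ)).clog hs
    simpa using this
  exact h

lemma im_deriv_logSum_neg (hm : ∀ i, 0 ≤ m i) (hm' : ∃ i, 0 < m i) {z : ℂ} (hz : z ∈ upperHalf) :
    (∑ i, (m i : ℂ) * (z - p i)⁻¹).im < 0 := by
  have hz' : 0 < z.im := hz
  rw [im_sum]
  have e : ∀ i, ((m i : ℂ) * (z - p i)⁻¹).im = -(m i * (z.im / normSq (z - p i))) := fun i => by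
    simp [inv_im, neg_div]
  have hn : ∀ i, 0 < z.im / normSq (z - p i) := fun i =>
    div_pos hz' (normSq_pos.2 fun h => by
      have := congrArg im h
      rw [sub_ofReal_im] at this
      exact hz'.ne' this)
  simp only [e, Finset.sum_neg_distrib, neg_lt_zero]
  obtain ⟨i, hi⟩ := hm'
  exact Finset.sum_pos' (fun i _ => mul_nonneg (hm i) (hn i).le)
    ⟨i, Finset.mem_univ _, mul_pos hi (hn i)⟩

/-- Noshiro–Warschawski argument. Each 1/(z - p) maps the upper half-plane into the lower one, so
the derivative has negative imaginary part. Equal values at z and w would, by Rolle on the segment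
for Im(W/(w - z)), give a point where that imaginary part vanishes. -/
lemma injOn_logSum (hm : ∀ i, 0 ≤ m i) (hm' : ∃ i, 0 < m i) : InjOn (logSum m p) upperHalf := by
  intro z hz w hw hzw
  by_contra hne
  have hd : w - z ≠ 0 := sub_ne_zero.2 (Ne.symm hne)
  set γ : ℝ → ℂ := fun s => z + s * (w - z) with hγ
  have hmem : ∀ s ∈ Icc (0 : ℝ) 1, γ s ∈ upperHalf := by
    intro s hs
    have := convex_upperHalf.add_smul_sub_mem hz hw hs
    simpa [hγ] using this
  have hγd : ∀ s : ℝ, HasDerivAt γ (w - z) s := fun s => by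
    have := (((hasDerivAt_id' (s : ℂ)).mul_const (w - z)).const_add z).comp_ofReal
    rwa [one_mul] at this
  have hder : ∀ s ∈ Icc (0 : ℝ) 1, HasDerivAt (fun s => (logSum m p (γ s) / (w - z)).im)
      (∑ i, (m i : ℂ) * (γ s - p i)⁻¹).im s := by
    intro s hs
    have h1 : HasDerivAt (fun s => logSum m p (γ s)) ((∑ i, (m i : ℂ) * (γ s - p i)⁻¹) * (w - z)) s :=
      (hasDerivAt_logSum m p (hmem s hs)).comp s (hγd s)
    have h2 := h1.div_const (w - z)
    rw [mul_div_cancel_right₀ _ hd] at h2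
    exact (imCLM.hasFDerivAt.comp_hasDerivAt s h2)
  obtain ⟨s, hs, h0⟩ := exists_hasDerivAt_eq_zero (f := fun s => (logSum m p (γ s) / (w - z)).im)
    (f' := fun s => (∑ i, (m i : ℂ) * (γ s - p i)⁻¹).im) zero_lt_one
    (fun s hs => (hder s hs).continuousAt.continuousWithinAt)
    (by simp [hγ, hzw]) (fun s hs => hder s ⟨hs.1.le, hs.2.le⟩)
  exact (im_deriv_logSum_neg hm hm' (hmem s ⟨hs.1.le, hs.2.le⟩)).ne h0

lemma logSum_im_mem (hm : ∀ i, 0 ≤ m i) (hm' : ∃ i, 0 < m i) {z : ℂ} (hz : z ∈ upperHalf) :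
    0 < (logSum m p z).im ∧ (logSum m p z).im < Real.pi * ∑ i, m i := by
  have ha : ∀ i, arg (z - p i) ∈ Ioo 0 Real.pi := fun i =>
    arg_mem_Ioo_of_im_pos (by rw [sub_ofReal_im]; exact hz)
  obtain ⟨i, hi⟩ := hm'
  rw [logSum_im, Finset.mul_sum]
  constructor
  · exact Finset.sum_pos' (fun i _ => mul_nonneg (hm i) (ha i).1.le)
      ⟨i, Finset.mem_univ _, mul_pos hi (ha i).1⟩
  · refine Finset.sum_lt_sum (fun i _ => ?_) ⟨i, Finset.mem_univ _, ?_⟩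
    · rw [mul_comm]; exact mul_le_mul_of_nonneg_right (ha i).2.le (hm i)
    · rw [mul_comm]; exact mul_lt_mul_of_pos_right (ha i).2 hi

/-- The real point `t` carries no mass. -/
def IsRegular (m p : ι → ℝ) (t : ℝ) : Prop := ∀ i, m i ≠ 0 → p i ≠ t

/-- The principal logarithm is continuous from above on the negative axis, where its argument is π;
massless points are harmless because their terms vanish. -/
lemma tendsto_logSum_of_isRegular {t : ℝ} (ht : IsRegular m p t) :
    Tendsto (logSum m p) (𝓝[upperHalf] (t : ℂ)) (𝓝 (logSum m p t)) := by
  unfold logSum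
  refine tendsto_finsetSum _ fun i _ => ?_
  by_cases hi : m i = 0
  · simp only [hi, ofReal_zero, zero_mul]
    exact tendsto_const_nhds
  refine Tendsto.const_mul _ ?_
  have hsub : Tendsto (fun z : ℂ => z - p i) (𝓝[upperHalf] (t : ℂ)) (𝓝[{z | 0 ≤ z.im}] ((t : ℂ) - p i)) := by
    refine tendsto_nhdsWithin_iff.2 ⟨?_, ?_⟩
    · exact (Continuous.tendsto (by fun_prop) _).mono_left nhdsWithin_le_nhds
    · filter_upwards [self_mem_nhdsWithin] with z hz
      show 0 ≤ (z - p i).im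
      rw [sub_ofReal_im]
      exact le_of_lt hz
  have hc : ContinuousWithinAt log {z : ℂ | 0 ≤ z.im} ((t : ℂ) - p i) := by
    rcases lt_or_gt_of_ne (ht i hi) with h | h
    · refine (continuousAt_clog ?_).continuousWithinAt
      rw [← ofReal_sub, ofReal_mem_slitPlane]
      linarith
    · refine continuousWithinAt_log_of_re_neg_of_im_zero ?_ ?_
      · rw [← ofReal_sub, ofReal_re]; linarith
      · rw [← ofReal_sub, ofReal_im]
  exact hc.tendsto.comp hsub

lemma logSum_ofReal_re (m p : ι → ℝ) (t : ℝ) :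
    (logSum m p t).re = ∑ i, m i * Real.log |t - p i| := by
  rw [logSum_re]
  simp only [← ofReal_sub, norm_real, Real.norm_eq_abs]

lemma logSum_ofReal_im (m p : ι → ℝ) (t : ℝ) :
    (logSum m p t).im = Real.pi * ∑ i, if t < p i then m i else 0 := by
  rw [logSum_im, Finset.mul_sum]
  refine Finset.sum_congr rfl fun i _ => ?_
  rw [← ofReal_sub]
  split_ifs with h
  · rw [arg_ofReal_of_neg (sub_neg.2 h), mul_comm]
  · rw [arg_ofReal_of_nonneg (sub_nonneg.2 (not_lt.1 h)), mul_zero, mul_zero]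

lemma tendsto_logSum_re_atBot (hm : ∀ i, 0 ≤ m i) {k : ι} (hk : 0 < m k) :
    Tendsto (fun z => (logSum m p z).re) (𝓝[upperHalf] (p k : ℂ)) atBot := by
  classical
  have hne : ∀ᶠ z : ℂ in 𝓝[upperHalf] (p k : ℂ), z ≠ p k := by
    filter_upwards [self_mem_nhdsWithin] with z hz h
    have hz' : 0 < z.im := hz
    rw [h, ofReal_im] at hz'
    exact lt_irrefl _ hz'
  have h0 : Tendsto (fun z : ℂ => ‖z - p k‖) (𝓝[upperHalf] (p k : ℂ)) (𝓝[>] 0) := by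
    refine tendsto_nhdsWithin_iff.2 ⟨?_, ?_⟩
    · have : Continuous fun z : ℂ => ‖z - p k‖ := by fun_prop
      have := this.tendsto (p k : ℂ)
      rw [sub_self, norm_zero] at this
      exact this.mono_left nhdsWithin_le_nhds
    · exact hne.mono fun z hz => norm_pos_iff.2 (sub_ne_zero.2 hz)
  have h1 : Tendsto (fun z : ℂ => m k * Real.log ‖z - p k‖) (𝓝[upperHalf] (p k : ℂ)) atBot :=
    (Real.tendsto_log_nhdsGT_zero.comp h0).const_mul_atBot hk
  -- An upper bound for the other terms on the unit disc around p k. It remains valid if some p i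
  -- coincides with p k.
  set K : ℝ := ∑ i ∈ Finset.univ.erase k, m i * Real.log (|p k - p i| + 1) with hK
  refine tendsto_atBot_mono' _ ?_ (tendsto_atBot_add_const_right _ K h1)
  have hball : ∀ᶠ z : ℂ in 𝓝[upperHalf] (p k : ℂ), z ∈ Metric.ball (p k : ℂ) 1 :=
    nhdsWithin_le_nhds (Metric.ball_mem_nhds _ one_pos)
  filter_upwards [hball, self_mem_nhdsWithin] with z hz hzH
  rw [logSum_re, ← Finset.add_sum_erase _ _ (Finset.mem_univ k)]
  refine add_le_add le_rfl (Finset.sum_le_sum fun i _ => mul_le_mul_of_nonneg_left ?_ (hm i))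
  refine Real.log_le_log (norm_pos_iff.2 fun h => ?_) ?_
  · have := congrArg im h
    rw [sub_ofReal_im] at this
    exact (ne_of_gt hzH) this
  · have e : z - p i = ((p k - p i : ℝ) : ℂ) + (z - p k) := by push_cast; ring
    rw [e]
    refine (norm_add_le _ _).trans ?_
    rw [norm_real, Real.norm_eq_abs]
    have := (mem_ball_iff_norm.1 hz).le
    linarith

lemma log_sub_sub_log_isBigO (t : ℝ) :
    (fun z : ℂ => log (z - t) - log z) =O[Bornology.cobounded ℂ ⊓ 𝓟 upperHalf] fun z => 1 / z := by
  refine Asymptotics.IsBigO.of_bound (3 / 2 * |t|) ?_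
  have hinv : Tendsto (fun z : ℂ => -((t : ℂ) * z⁻¹)) (Bornology.cobounded ℂ ⊓ 𝓟 upperHalf) (𝓝 0) := by
    have := (tendsto_inv₀_cobounded (α := ℂ)).const_mul (t : ℂ)
    rw [mul_zero] at this
    simpa using this.neg.mono_left (inf_le_left (b := 𝓟 upperHalf))
  have hsmall := hinv.eventually (Metric.closedBall_mem_nhds 0 (by norm_num : (0 : ℝ) < 1 / 2))
  filter_upwards [hsmall, mem_inf_of_right (mem_principal_self _)] with z hz hzH
  have hzim : 0 < z.im := hzH
  have hz0 : z ≠ 0 := by rintro rfl; simp at hzim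
  have hzt : z - t ≠ 0 := fun h => by
    have := congrArg im h
    rw [sub_ofReal_im] at this
    exact hzim.ne' this
  -- No multiple of 2πi appears: both arguments lie in (0, π), so their difference lies in (-π, π).
  have e : log (z - t) - log z = log (1 + -((t : ℂ) * z⁻¹)) := by
    have h1 : exp (log (z - t) - log z) = 1 + -((t : ℂ) * z⁻¹) := by
      rw [exp_sub, exp_log hzt, exp_log hz0]
      field_simp
      ring
    have ha := arg_mem_Ioo_of_im_pos (z := z - t) (by rw [sub_ofReal_im]; exact hzim)
    have hb := arg_mem_Ioo_of_im_pos hzim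
    rw [← h1, log_exp]
    · rw [sub_im, log_im, log_im]; linarith [ha.1, hb.2]
    · rw [sub_im, log_im, log_im]; linarith [ha.2, hb.1]
  rw [e]
  have hz' : ‖-((t : ℂ) * z⁻¹)‖ ≤ 1 / 2 := by simpa using hz
  refine (norm_log_one_add_half_le_self hz').trans (le_of_eq ?_)
  rw [norm_neg, norm_mul, norm_real, Real.norm_eq_abs, one_div]
  ring

lemma logSum_sub_isBigO (m p : ι → ℝ) :
    (fun z : ℂ => logSum m p z - ((∑ i, m i : ℝ) : ℂ) * log z)
      =O[Bornology.cobounded ℂ ⊓ 𝓟 upperHalf] fun z => 1 / z := by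
  have e : (fun z : ℂ => logSum m p z - ((∑ i, m i : ℝ) : ℂ) * log z)
      = fun z => ∑ i, (m i : ℂ) * (log (z - p i) - log z) := by
    funext z
    rw [logSum, ofReal_sum, Finset.sum_mul, ← Finset.sum_sub_distrib]
    exact Finset.sum_congr rfl fun i _ => by ring
  rw [e]
  exact Asymptotics.IsBigO.fun_sum fun i _ => (log_sub_sub_log_isBigO (p i)).const_mul_left _

lemma tendsto_one_div_cobounded :
    Tendsto (fun z : ℂ => 1 / z) (Bornology.cobounded ℂ ⊓ 𝓟 upperHalf) (𝓝 0) := by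
  simpa using (tendsto_inv₀_cobounded (α := ℂ)).mono_left (inf_le_left (b := 𝓟 upperHalf))

lemma tendsto_logSum_re_atTop (hm : 0 < ∑ i, m i) :
    Tendsto (fun z => (logSum m p z).re) (Bornology.cobounded ℂ ⊓ 𝓟 upperHalf) atTop := by
  have h1 := (logSum_sub_isBigO m p).trans_tendsto tendsto_one_div_cobounded
  have h2 : Tendsto (fun z : ℂ => (logSum m p z - ((∑ i, m i : ℝ) : ℂ) * log z).re)
      (Bornology.cobounded ℂ ⊓ 𝓟 upperHalf) (𝓝 0) := by
    exact (continuous_re.tendsto 0).comp h1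
  have h3 : Tendsto (fun z : ℂ => (∑ i, m i) * Real.log ‖z‖)
      (Bornology.cobounded ℂ ⊓ 𝓟 upperHalf) atTop :=
    ((Real.tendsto_log_atTop.comp tendsto_norm_cobounded_atTop).const_mul_atTop hm).mono_left
      inf_le_left
  refine (h3.atTop_add h2).congr fun z => ?_
  rw [sub_re, re_ofReal_mul, log_re]
  ring

/-- The limit points of the upper half-plane. -/
lemma ultrafilter_cases {κ : Type*} (m p : κ → ℝ) (G : Ultrafilter ℂ) (hG : (G : Filter ℂ) ≤ 𝓟 upperHalf) :
    (G : Filter ℂ) ≤ Bornology.cobounded ℂ ⊓ 𝓟 upperHalf ∨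
    (∃ i, m i ≠ 0 ∧ (G : Filter ℂ) ≤ 𝓝[upperHalf] (p i : ℂ)) ∨
    (∃ t : ℝ, IsRegular m p t ∧ (G : Filter ℂ) ≤ 𝓝[upperHalf] (t : ℂ)) ∨
    ∃ z ∈ upperHalf, (G : Filter ℂ) ≤ 𝓝 z := by
  -- An ultrafilter that does not go to infinity contains a compact set and so converges; its limit
  -- is in the closed half-plane.
  by_cases hc : (G : Filter ℂ) ≤ Bornology.cobounded ℂ
  · exact Or.inl (le_inf hc hG)
  obtain ⟨s, hs, hsG⟩ := Filter.not_le.1 hc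
  rw [Metric.cobounded_eq_cocompact, mem_cocompact] at hs
  obtain ⟨K, hK, hKs⟩ := hs
  have hKG : K ∈ G := by
    by_contra h
    exact hsG (mem_of_superset (Ultrafilter.compl_mem_iff_notMem.2 h) hKs)
  obtain ⟨z, -, hz⟩ := isCompact_iff_ultrafilter_le_nhds.1 hK G (le_principal_iff.2 hKG)
  have hzim : 0 ≤ z.im := by
    have hcl : IsClosed {z : ℂ | 0 ≤ z.im} := isClosed_le continuous_const continuous_im
    have hev : ∀ᶠ w in (G : Filter ℂ), id w ∈ {z : ℂ | 0 ≤ z.im} :=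
      mem_of_superset (le_principal_iff.1 hG) fun w (hw : 0 < w.im) => hw.le
    exact hcl.mem_of_tendsto hz hev
  rcases hzim.eq_or_lt with h | h
  · have hzr : z = (z.re : ℂ) := Complex.ext rfl (by simp [← h])
    rw [hzr] at hz
    have hz' : (G : Filter ℂ) ≤ 𝓝[upperHalf] (z.re : ℂ) := le_inf hz hG
    by_cases hr : IsRegular m p z.re
    · exact Or.inr (Or.inr (Or.inl ⟨_, hr, hz'⟩))
    · unfold IsRegular at hr
      push Not at hr
      obtain ⟨i, hi, hpi⟩ := hr
      exact Or.inr (Or.inl ⟨i, hi, hpi ▸ hz'⟩)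
  · exact Or.inr (Or.inr (Or.inr ⟨z, h, hz⟩))

/-- The step function `t ↦ 1_{s < t}`, with the value `1 / 2` at the jump. -/
def halfStep (s t : ℝ) : ℝ := if s < t then 1 else if s = t then 1 / 2 else 0

lemma halfStep_of_lt {s t : ℝ} (h : s < t) : halfStep s t = 1 := if_pos h

lemma halfStep_of_gt {s t : ℝ} (h : t < s) : halfStep s t = 0 := by
  rw [halfStep, if_neg h.not_gt, if_neg h.ne']

lemma halfStep_self (s : ℝ) : halfStep s s = 1 / 2 := by
  rw [halfStep, if_neg (lt_irrefl s), if_pos rfl]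

lemma halfStep_nonneg (s t : ℝ) : 0 ≤ halfStep s t := by
  unfold halfStep
  split_ifs <;> norm_num

lemma halfStep_le_one (s t : ℝ) : halfStep s t ≤ 1 := by
  unfold halfStep
  split_ifs <;> norm_num

/-- A point on the vertical line above p i has argument π/2 relative to p i, whence the half jump.
The limit serves later to decide on which side of a cut the map runs near a singular point. -/
lemma tendsto_logSum_im_vertical (m p : ι → ℝ) (t : ℝ) :
    Tendsto (fun s : ℝ => (logSum m p (t + s * I)).im) (𝓝[>] 0)
      (𝓝 (Real.pi * ∑ i, m i * halfStep t (p i))) := by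
  simp only [logSum_im, Finset.mul_sum]
  refine tendsto_finsetSum _ fun i _ => ?_
  rw [mul_left_comm]
  refine Tendsto.const_mul _ ?_
  by_cases ht : t = p i
  · rw [ht, halfStep_self]
    refine tendsto_const_nhds.congr' ?_
    filter_upwards [self_mem_nhdsWithin] with s hs
    rw [add_sub_cancel_left, arg_real_mul _ hs, arg_I]
    ring
  · have hreg : IsRegular (fun _ : Unit => (1 : ℝ)) (fun _ => p i) t := fun _ _ => Ne.symm ht
    have h1 := (tendsto_logSum_of_isRegular hreg).comp (tendsto_vertical t)
    have h2 := (continuous_im.tendsto _).comp h1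
    rw [logSum_ofReal_im] at h2
    simp only [halfStep, if_neg ht]
    simpa [logSum, log_im, Function.comp_def] using h2

end LogSum

section CombMap

open Filter Topology Set Complex

/-! ### The conformal map built from a Chebyshev polynomial -/

/-- The masses of the logarithmic potential. -/
def masses (α β : ℝ) (n : ℕ) : Fin n ⊕ Fin 2 → ℝ := Sum.elim (fun _ => 1) ![α, β]

/-- The points that carry the masses. -/
def points {n : ℕ} (x : Fin n → ℝ) : Fin n ⊕ Fin 2 → ℝ := Sum.elim x ![0, 1]

lemma sum_masses_mul (α β : ℝ) {n : ℕ} (f : Fin n ⊕ Fin 2 → ℝ) :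
    ∑ i, masses α β n i * f i = ∑ j, f (Sum.inl j) + (α * f (Sum.inr 0) + β * f (Sum.inr 1)) := by
  simp [masses, Fintype.sum_sum_type]

lemma sum_masses (α β : ℝ) (n : ℕ) : ∑ i, masses α β n i = α + β + n := by
  have := sum_masses_mul α β (n := n) fun _ => 1
  simp only [mul_one, Finset.sum_const, Finset.card_univ, Fintype.card_fin, nsmul_eq_mul] at this
  rw [this]; ring

lemma masses_nonneg {α β : ℝ} (hα : 0 ≤ α) (hβ : 0 ≤ β) {n : ℕ} (i : Fin n ⊕ Fin 2) :
    0 ≤ masses α β n i := by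
  rcases i with j | j
  · simp [masses]
  · fin_cases j <;> simpa [masses]

lemma exists_masses_pos {α β : ℝ} {n : ℕ} (hpos : 0 < α + β + n) :
    ∃ i, 0 < masses α β n i := by
  by_contra! h
  have := Finset.sum_nonpos fun i (_ : i ∈ Finset.univ) => h i
  rw [sum_masses] at this
  linarith

lemma isRegular_iff {α β : ℝ} {n : ℕ} {x : Fin n → ℝ} {t : ℝ} :
    IsRegular (masses α β n) (points x) t ↔
      (∀ j, x j ≠ t) ∧ (α ≠ 0 → 0 ≠ t) ∧ (β ≠ 0 → 1 ≠ t) := by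
  simp [IsRegular, Sum.forall, Fin.forall_fin_two, masses, points]

/-- The conformal map onto the comb domain. -/
def combMap (α β M : ℝ) {n : ℕ} (x : Fin n → ℝ) (z : ℂ) : ℂ :=
  logSum (masses α β n) (points x) z + ((-Real.log M : ℝ) : ℂ) - (β : ℂ) * Real.pi * I

section

variable {α β M : ℝ} {n : ℕ} {x : Fin n → ℝ} {ξ : Fin (n + 1) → ℝ}

lemma combMap_re (z : ℂ) :
    (combMap α β M x z).re = (logSum (masses α β n) (points x) z).re - Real.log M := by
  simp only [combMap, sub_re, add_re, ofReal_re, mul_re, mul_im, ofReal_im, I_re, I_im]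
  ring

lemma combMap_im (z : ℂ) :
    (combMap α β M x z).im = (logSum (masses α β n) (points x) z).im - Real.pi * β := by
  simp only [combMap, sub_im, add_im, ofReal_re, mul_re, mul_im, ofReal_im, I_re, I_im]
  ring

lemma combMap_im_div_pi (z : ℂ) : (combMap α β M x z).im / Real.pi =
    (logSum (masses α β n) (points x) z).im / Real.pi - β := by
  rw [combMap_im]
  field_simp

lemma hasDerivAt_combMap {z : ℂ} (hz : z ∈ upperHalf) : HasDerivAt (combMap α β M x)
    (∑ i, (masses α β n i : ℂ) * (z - points x i)⁻¹) z :=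
  ((hasDerivAt_logSum _ _ hz).add_const _).sub_const _

lemma differentiableOn_combMap : DifferentiableOn ℂ (combMap α β M x) upperHalf := fun _ hz =>
  (hasDerivAt_combMap hz).differentiableAt.differentiableWithinAt

lemma continuousOn_combMap : ContinuousOn (combMap α β M x) upperHalf :=
  differentiableOn_combMap.continuousOn

lemma injOn_combMap (hα : 0 ≤ α) (hβ : 0 ≤ β) (hpos : 0 < α + β + n) :
    InjOn (combMap α β M x) upperHalf := by
  intro z hz w hw h
  refine injOn_logSum (p := points x) (masses_nonneg hα hβ) (exists_masses_pos hpos) hz hw ?_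
  simpa [combMap] using h

lemma map_nhds_combMap (hα : 0 ≤ α) (hβ : 0 ≤ β) (hpos : 0 < α + β + n) {z : ℂ}
    (hz : z ∈ upperHalf) : map (combMap α β M x) (𝓝 z) = 𝓝 (combMap α β M x z) := by
  have hd := deriv_ne_zero_of_injOn isOpen_upperHalf
    (differentiableOn_combMap (α := α) (β := β) (M := M) (x := x)) (injOn_combMap hα hβ hpos) hz
  exact ((differentiableOn_combMap.analyticAt
    (isOpen_upperHalf.mem_nhds hz)).hasStrictDerivAt).map_nhds_eq hd

lemma combMap_mem_strip (hα : 0 ≤ α) (hβ : 0 ≤ β) (hpos : 0 < α + β + n) {z : ℂ}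
    (hz : z ∈ upperHalf) : -β < (combMap α β M x z).im / Real.pi ∧
      (combMap α β M x z).im / Real.pi < α + n := by
  have h := logSum_im_mem (p := points x) (masses_nonneg hα hβ) (exists_masses_pos hpos) hz
  rw [sum_masses] at h
  rw [combMap_im_div_pi]
  constructor
  · have := div_pos h.1 Real.pi_pos
    linarith
  · have := (div_lt_iff₀' Real.pi_pos).2 h.2
    linarith

lemma tendsto_combMap_of_isRegular {t : ℝ} (ht : IsRegular (masses α β n) (points x) t) :
    Tendsto (combMap α β M x) (𝓝[upperHalf] (t : ℂ)) (𝓝 (combMap α β M x t)) :=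
  ((tendsto_logSum_of_isRegular ht).add_const _).sub_const _

lemma tendsto_combMap_re_atBot (hα : 0 ≤ α) (hβ : 0 ≤ β) {i : Fin n ⊕ Fin 2}
    (hi : masses α β n i ≠ 0) :
    Tendsto (fun z => (combMap α β M x z).re) (𝓝[upperHalf] (points x i : ℂ)) atBot := by
  simp only [combMap_re, sub_eq_add_neg]
  exact tendsto_atBot_add_const_right _ _
    (tendsto_logSum_re_atBot (masses_nonneg hα hβ) ((masses_nonneg hα hβ i).lt_of_ne' hi))

lemma tendsto_combMap_re_atTop (hpos : 0 < α + β + n) :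
    Tendsto (fun z => (combMap α β M x z).re) (Bornology.cobounded ℂ ⊓ 𝓟 upperHalf) atTop := by
  simp only [combMap_re, sub_eq_add_neg]
  exact tendsto_atTop_add_const_right _ _ (tendsto_logSum_re_atTop (by rwa [sum_masses]))

/-- The number of zeros to the right of `t`. -/
def zerosAbove (x : Fin n → ℝ) (t : ℝ) : ℕ := (Finset.univ.filter fun j => t < x j).card

lemma zerosAbove_le (x : Fin n → ℝ) (t : ℝ) : zerosAbove x t ≤ n := by
  simpa [zerosAbove] using Finset.card_filter_le (Finset.univ : Finset (Fin n)) fun j => t < x j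

lemma zerosAbove_eq {i : Fin (n + 1)} {t : ℝ}
    (hl : ∀ j, Fin.castSucc j < i → x j ≤ t) (hr : ∀ j, i ≤ Fin.castSucc j → t < x j) :
    zerosAbove x t = n - i := by
  have e : (Finset.univ.filter fun j => t < x j) = Finset.univ.filter fun j : Fin n => ¬ j.val < i.val := by
    ext j
    simp only [Finset.mem_filter, Finset.mem_univ, true_and, not_lt]
    constructor
    · intro hj
      by_contra! hc
      exact (hl j (Fin.lt_def.2 (by simpa using hc))).not_gt hj
    · intro hj
      exact hr j (Fin.le_def.2 (by simpa using hj))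
  rw [zerosAbove, e, Finset.filter_not, Finset.card_sdiff_of_subset (Finset.filter_subset _ _),
    Finset.card_univ, Fintype.card_fin]
  congr 1
  have hi : i.val ≤ n := Nat.le_of_lt_succ i.2
  rw [Fin.card_filter_val_lt]
  exact min_eq_right hi

lemma combMap_im_ofReal (t : ℝ) : (combMap α β M x t).im / Real.pi =
    zerosAbove x t + α * (if t < 0 then 1 else 0) + β * (if t < 1 then 1 else 0) - β := by
  rw [combMap_im_div_pi, logSum_ofReal_im, mul_div_cancel_left₀ _ Real.pi_ne_zero]
  have : ∀ i, (if t < points x i then masses α β n i else 0)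
      = masses α β n i * (if t < points x i then 1 else 0) := fun i => by simp
  simp only [this]
  rw [sum_masses_mul]
  have hz : ∑ j, (if t < points x (Sum.inl j) then (1 : ℝ) else 0) = zerosAbove x t := by
    rw [zerosAbove, Finset.natCast_card_filter]
    rfl
  rw [hz, show points x (Sum.inr 0) = 0 from rfl, show points x (Sum.inr 1) = 1 from rfl]
  ring

lemma weighted_pos {t : ℝ} (ht : t ∈ Icc (0 : ℝ) 1)
    (hr : IsRegular (masses α β n) (points x) t) : 0 < weighted α β x t := by
  obtain ⟨h1, h2, h3⟩ := isRegular_iff.1 hr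
  refine mul_pos (mul_pos ?_ ?_) (Finset.prod_pos fun j _ => abs_pos.2 (sub_ne_zero.2 (h1 j).symm))
  · by_cases hα : α = 0
    · simp [hα]
    · exact Real.rpow_pos_of_pos (ht.1.lt_of_ne (h2 hα)) _
  · by_cases hβ : β = 0
    · simp [hβ]
    · exact Real.rpow_pos_of_pos (sub_pos.2 (ht.2.lt_of_ne (h3 hβ).symm)) _

lemma isRegular_of_weighted_pos {t : ℝ} (h : 0 < weighted α β x t) :
    IsRegular (masses α β n) (points x) t := by
  refine isRegular_iff.2 ⟨fun j hj => ?_, fun hα h0 => ?_, fun hβ h1 => ?_⟩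
  · rw [weighted, Finset.prod_eq_zero (Finset.mem_univ j) (by rw [hj, sub_self, abs_zero]),
      mul_zero] at h
    exact lt_irrefl _ h
  · simp [weighted, ← h0, Real.zero_rpow hα] at h
  · simp [weighted, ← h1, Real.zero_rpow hβ] at h

/-- Links the two problems: the bound M becomes real part ≤ 0, and alternation points become points
of real part 0. Endpoints with zero exponent are included, since s^0 = 1 also for s = 0. -/
lemma combMap_re_ofReal (hM : 0 < M) {t : ℝ} (ht : t ∈ Icc (0 : ℝ) 1)
    (hw : 0 < weighted α β x t) :
    (combMap α β M x t).re = Real.log (weighted α β x t / M) := by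
  rw [Real.log_div hw.ne' hM.ne', combMap_re, logSum_ofReal_re, sum_masses_mul]
  congr 1
  simp only [points, Sum.elim_inl, Sum.elim_inr, Matrix.cons_val_zero, Matrix.cons_val_one]
  have hr := isRegular_iff.1 (isRegular_of_weighted_pos hw)
  have h1 : ∀ s γ : ℝ, 0 ≤ s → (γ ≠ 0 → s ≠ 0) → Real.log (s ^ γ) = γ * Real.log s := by
    intro s γ hs h
    by_cases hγ : γ = 0
    · simp [hγ]
    · exact Real.log_rpow (hs.lt_of_ne' (h hγ)) _
  have hne : ∀ s γ : ℝ, 0 ≤ s → (γ ≠ 0 → s ≠ 0) → s ^ γ ≠ 0 := by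
    intro s γ hs h
    by_cases hγ : γ = 0
    · simp [hγ]
    · exact (Real.rpow_pos_of_pos (hs.lt_of_ne' (h hγ)) _).ne'
  have hA : α ≠ 0 → t ≠ 0 := fun h => (hr.2.1 h).symm
  have hB : β ≠ 0 → 1 - t ≠ 0 := fun h => sub_ne_zero.2 (hr.2.2 h)
  have ht1 := sub_nonneg.2 ht.2
  rw [weighted, Real.log_mul (mul_ne_zero (hne _ _ ht.1 hA) (hne _ _ ht1 hB)),
    Real.log_mul (hne _ _ ht.1 hA) (hne _ _ ht1 hB), h1 _ _ ht.1 hA, h1 _ _ ht1 hB, Real.log_prod,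
    sub_zero, abs_of_nonneg ht.1, abs_sub_comm, abs_of_nonneg ht1]
  · ring
  · exact fun j _ => abs_ne_zero.2 (sub_ne_zero.2 (hr.1 j).symm)
  · exact Finset.prod_ne_zero_iff.2 fun j _ => abs_ne_zero.2 (sub_ne_zero.2 (hr.1 j).symm)

lemma combMap_im_ofReal_of_mem {t : ℝ} (ht : t ∈ Icc (0 : ℝ) 1)
    (hr : IsRegular (masses α β n) (points x) t) :
    (combMap α β M x t).im / Real.pi = zerosAbove x t := by
  rw [combMap_im_ofReal, if_neg ht.1.not_gt]
  by_cases h1 : t < 1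
  · rw [if_pos h1]; ring
  · have h2 : t = 1 := le_antisymm ht.2 (not_lt.1 h1)
    have : β = 0 := by
      by_contra hβ
      exact (isRegular_iff.1 hr).2.2 hβ h2.symm
    rw [this]; ring

lemma mem_domain_iff {w : ℂ} : w ∈ domain n α β ↔
    (-β < w.im / Real.pi ∧ w.im / Real.pi < α + n) ∧
      ∀ j : ℕ, j ≤ n → w.im / Real.pi = j → 0 < w.re := by
  simp only [domain, Set.mem_sdiff, mem_ofPred_eq, mem_iUnion, not_exists, not_and, not_le]
  refine and_congr_right fun _ => ⟨fun h j hj => h ⟨j, Nat.lt_succ_of_le hj⟩, fun h j => h j ?_⟩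
  exact Nat.le_of_lt_succ j.2

end

/-! ### The comb map is a bijection onto the comb domain. -/

namespace IsChebyshev

variable {α β M : ℝ} {n : ℕ} {x : Fin n → ℝ} {ξ : Fin (n + 1) → ℝ}

lemma combMap_re_nonpos (h : IsChebyshev α β x ξ M) {t : ℝ} (ht : t ∈ Icc (0 : ℝ) 1)
    (hr : IsRegular (masses α β n) (points x) t) : (combMap α β M x t).re ≤ 0 := by
  have hw := weighted_pos ht hr
  rw [combMap_re_ofReal h.pos ht hw]
  exact Real.log_nonpos (div_nonneg hw.le h.pos.le) ((div_le_one h.pos).2 (h.le t ht))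

lemma zerosAbove_of_neg (h : IsChebyshev α β x ξ M) {t : ℝ} (ht : t ≤ 0) : zerosAbove x t = n := by
  rw [zerosAbove, Finset.filter_true_of_mem fun j _ => ht.trans_lt (h.zero_pos j)]
  simp

lemma zerosAbove_of_one_le (h : IsChebyshev α β x ξ M) {t : ℝ} (ht : 1 ≤ t) :
    zerosAbove x t = 0 := by
  rw [zerosAbove, Finset.filter_false_of_mem fun j _ => (((h.zero_lt_one j).trans_le ht).not_gt)]
  simp

/-- The boundary values of the conformal map lie off the comb domain. -/
lemma combMap_ofReal_notMem (h : IsChebyshev α β x ξ M) {t : ℝ}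
    (hr : IsRegular (masses α β n) (points x) t) : combMap α β M x t ∉ domain n α β := by
  rw [mem_domain_iff]
  rintro ⟨⟨h1, h2⟩, h3⟩
  rcases lt_or_ge t 0 with h0 | h0
  · rw [combMap_im_ofReal, h.zerosAbove_of_neg h0.le, if_pos h0, if_pos (h0.trans one_pos)] at h2
    linarith
  rcases lt_or_ge 1 t with h1' | h1'
  · rw [combMap_im_ofReal, h.zerosAbove_of_one_le h1'.le, if_neg h0.not_gt, if_neg h1'.not_gt] at h1
    simp at h1
  · exact (h3 _ (zerosAbove_le x t) (combMap_im_ofReal_of_mem ⟨h0, h1'⟩ hr)).not_ge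
      (h.combMap_re_nonpos ⟨h0, h1'⟩ hr)

lemma isOpen_image (hα : 0 ≤ α) (hβ : 0 ≤ β) (hpos : 0 < α + β + n) :
    IsOpen (combMap α β M x '' upperHalf) := by
  rw [isOpen_iff_mem_nhds]
  rintro _ ⟨z, hz, rfl⟩
  rw [← map_nhds_combMap hα hβ hpos hz]
  exact image_mem_map (isOpen_upperHalf.mem_nhds hz)

/-- Properness: take an ultrafilter on the half-plane whose image tends to w. At infinity or at a
mass the real part diverges, and at a regular real point the limit is off the domain; only an
interior limit point remains. -/
lemma closure_image_inter_subset (h : IsChebyshev α β x ξ M) (hα : 0 ≤ α) (hβ : 0 ≤ β)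
    (hpos : 0 < α + β + n) :
    closure (combMap α β M x '' upperHalf) ∩ domain n α β ⊆ combMap α β M x '' upperHalf := by
  rintro w ⟨hw, hwd⟩
  have hne : (comap (combMap α β M x) (𝓝 w) ⊓ 𝓟 upperHalf).NeBot := by
    rw [← map_neBot_iff (combMap α β M x), Filter.push_pull', map_principal]
    exact mem_closure_iff_nhdsWithin_neBot.1 hw
  obtain ⟨G, hG⟩ := Ultrafilter.exists_le (comap (combMap α β M x) (𝓝 w) ⊓ 𝓟 upperHalf)
  have hGw : Tendsto (combMap α β M x) G (𝓝 w) := tendsto_iff_comap.2 (hG.trans inf_le_left)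
  have hGre := (continuous_re.tendsto w).comp hGw
  rcases ultrafilter_cases (masses α β n) (points x) G (hG.trans inf_le_right) with
    h1 | ⟨i, hi, h1⟩ | ⟨t, ht, h1⟩ | ⟨z, hz, h1⟩
  · exact absurd hGre (not_tendsto_nhds_of_tendsto_atTop ((tendsto_combMap_re_atTop hpos).mono_left h1) _)
  · exact absurd hGre
      (not_tendsto_nhds_of_tendsto_atBot ((tendsto_combMap_re_atBot hα hβ hi).mono_left h1) _)
  · have := tendsto_nhds_unique hGw ((tendsto_combMap_of_isRegular ht).mono_left h1)
    exact absurd (this ▸ hwd) (h.combMap_ofReal_notMem ht)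
  · refine ⟨z, hz, ?_⟩
    have hc := (continuousOn_combMap (α := α) (β := β) (M := M) (x := x)).continuousAt
      (isOpen_upperHalf.mem_nhds hz)
    exact tendsto_nhds_unique (hc.tendsto.mono_left h1) hGw

end IsChebyshev

/-- The cuts extend to the left, so every point slides right along a horizontal ray into the convex
half-strip of positive real part. -/
lemma isPreconnected_domain {n : ℕ} {α β : ℝ} : IsPreconnected (domain n α β) := by
  set H : Set ℂ := {w | -β < w.im / Real.pi ∧ w.im / Real.pi < α + n ∧ 0 < w.re} with hH
  have hHc : Convex ℝ H := by
    have e : H = {w : ℂ | -β * Real.pi < w.im} ∩ {w : ℂ | w.im < (α + n) * Real.pi} ∩ {w : ℂ | 0 < w.re} := by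
      ext w
      simp only [hH, mem_ofPred_eq, mem_inter_iff, lt_div_iff₀ Real.pi_pos, div_lt_iff₀ Real.pi_pos,
        and_assoc]
    rw [e]
    exact ((convex_halfSpace_im_gt _).inter (convex_halfSpace_im_lt _)).inter
      (convex_halfSpace_re_gt _)
  have hHs : H ⊆ domain n α β := fun w hw =>
    mem_domain_iff.2 ⟨⟨hw.1, hw.2.1⟩, fun _ _ _ => hw.2.2⟩
  rcases (domain n α β).eq_empty_or_nonempty with h0 | ⟨w₀, hw₀⟩
  · rw [h0]; exact isPreconnected_empty
  have hstep : ∀ w ∈ domain n α β, ∀ s : ℝ, 0 ≤ s → w + s ∈ domain n α β := by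
    intro w hw s hs
    obtain ⟨h1, h2⟩ := mem_domain_iff.1 hw
    refine mem_domain_iff.2 ⟨by simpa using h1, fun j hj he => ?_⟩
    have := h2 j hj (by simpa using he)
    simp only [add_re, ofReal_re]
    linarith
  have hbig : ∀ w ∈ domain n α β, w + ((|w.re| + 1 : ℝ) : ℂ) ∈ H := by
    intro w hw
    obtain ⟨h1, h2⟩ := mem_domain_iff.1 hw
    refine ⟨by simpa using h1.1, by simpa using h1.2, ?_⟩
    simp only [add_re, ofReal_re]
    linarith [neg_abs_le w.re]
  refine isPreconnected_of_forall (w₀ + ((|w₀.re| + 1 : ℝ) : ℂ)) fun w hw => ?_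
  set R : Set ℂ := (fun s : ℝ => w + s) '' Ici 0 with hR
  refine ⟨R ∪ H, union_subset ?_ hHs, Or.inr (hbig _ hw₀), Or.inl ⟨0, by simp, by simp⟩, ?_⟩
  · rintro _ ⟨s, hs, rfl⟩
    exact hstep w hw s hs
  · refine IsPreconnected.union (w + ((|w.re| + 1 : ℝ) : ℂ)) ⟨|w.re| + 1, ?_, rfl⟩ (hbig w hw) ?_
      hHc.isPreconnected
    · exact mem_Ici.2 (by positivity)
    · exact isPreconnected_Ici.image _ (Continuous.continuousOn (by fun_prop))

namespace IsChebyshev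

variable {α β M : ℝ} {n : ℕ} {x : Fin n → ℝ} {ξ : Fin (n + 1) → ℝ}

/-- The image is open and relatively closed in the connected domain; it meets it because the real
part becomes positive near infinity. -/
lemma domain_subset_image (h : IsChebyshev α β x ξ M) (hα : 0 ≤ α) (hβ : 0 ≤ β)
    (hpos : 0 < α + β + n) : domain n α β ⊆ combMap α β M x '' upperHalf := by
  refine isPreconnected_domain.subset_of_closure_inter_subset (isOpen_image hα hβ hpos) ?_
    (h.closure_image_inter_subset hα hβ hpos)
  have h1 := (tendsto_combMap_re_atTop (M := M) (x := x) hpos).eventually_gt_atTop 0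
  obtain ⟨z, hz, hzH⟩ := (h1.and (mem_inf_of_right (mem_principal_self upperHalf))).exists
  exact ⟨_, mem_domain_iff.2 ⟨combMap_mem_strip hα hβ hpos hzH, fun _ _ _ => hz⟩, z, hzH, rfl⟩

/-- Every value in `(0, M]` is attained next to each alternation point. -/
lemma exists_weighted_eq (h : IsChebyshev α β x ξ M) (hα : 0 ≤ α) (hβ : 0 ≤ β)
    (hpos : 0 < α + β + n) (i : Fin (n + 1)) {c : ℝ} (hc : 0 < c) (hcM : c ≤ M) :
    ∃ t ∈ Icc (0 : ℝ) 1, weighted α β x t = c ∧ zerosAbove x t = n - i := by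
  have hcont := continuous_weighted_right hα hβ x
  have zero_at : ∀ j, weighted α β x (x j) = 0 := fun j => by
    rw [weighted, Finset.prod_eq_zero (Finset.mem_univ j) (by rw [sub_self, abs_zero]), mul_zero]
  -- Intermediate values between ξ i, where the weighted modulus is M, and a point s bounding the
  -- gap where it vanishes.
  have left : ∀ s ∈ Icc (0 : ℝ) 1, s ≤ ξ i → weighted α β x s = 0 →
      (∀ j, Fin.castSucc j < i → x j ≤ s) →
      ∃ t ∈ Icc (0 : ℝ) 1, weighted α β x t = c ∧ zerosAbove x t = n - i := by
    intro s hs hsξ hs0 hsx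
    obtain ⟨t, ht, htc⟩ := intermediate_value_Icc hsξ hcont.continuousOn
      (show c ∈ Icc (weighted α β x s) (weighted α β x (ξ i)) by rw [hs0, h.eq]; exact ⟨hc.le, hcM⟩)
    exact ⟨t, ⟨hs.1.trans ht.1, ht.2.trans (h.mem i).2⟩, htc,
      zerosAbove_eq (fun j hj => (hsx j hj).trans ht.1) fun j hj => ht.2.trans_lt (h.lt_zero i j hj)⟩
  have right : ∀ s ∈ Icc (0 : ℝ) 1, ξ i ≤ s → weighted α β x s = 0 →
      (∀ j, i ≤ Fin.castSucc j → s ≤ x j) →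
      ∃ t ∈ Icc (0 : ℝ) 1, weighted α β x t = c ∧ zerosAbove x t = n - i := by
    intro s hs hsξ hs0 hsx
    obtain ⟨t, ht, htc⟩ := intermediate_value_Icc' hsξ hcont.continuousOn
      (show c ∈ Icc (weighted α β x s) (weighted α β x (ξ i)) by rw [hs0, h.eq]; exact ⟨hc.le, hcM⟩)
    -- Only zeros strictly above t are counted, so a right end point that is a zero has to be
    -- excluded.
    have hts : t ≠ s := by rintro rfl; exact hc.ne (hs0.symm.trans htc)
    exact ⟨t, ⟨(h.mem i).1.trans ht.1, ht.2.trans hs.2⟩, htc,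
      zerosAbove_eq (fun j hj => (h.zero_lt i j hj).le.trans ht.1)
        fun j hj => (ht.2.lt_of_ne hts).trans_le (hsx j hj)⟩
  have hunit : ∀ j, x j ∈ Icc (0 : ℝ) 1 := fun j => ⟨(h.zero_pos j).le, (h.zero_lt_one j).le⟩
  rcases Fin.eq_zero_or_eq_succ i with rfl | ⟨a, rfl⟩
  · rcases Nat.eq_zero_or_pos n with rfl | hn
    -- Without zeros, s is an end point of [0, 1] with positive exponent, which exists because α + β
    -- > 0.
    · rcases hα.eq_or_lt with h0 | h0
      · have hβ0 : β ≠ 0 := by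
          rintro rfl
          simp [← h0] at hpos
        exact right 1 ⟨zero_le_one, le_rfl⟩ (h.mem 0).2 (by simp [weighted, Real.zero_rpow hβ0])
          fun j => j.elim0
      · exact left 0 ⟨le_rfl, zero_le_one⟩ (h.mem 0).1 (by simp [weighted, Real.zero_rpow h0.ne'])
          fun j => j.elim0
    · exact right (x ⟨0, hn⟩) (hunit _) (h.lt_zero _ _ (Fin.zero_le _)).le (zero_at _)
        fun j _ => h.strictMono.monotone (Fin.mk_le_of_le_val (Nat.zero_le _))
  · exact left (x a) (hunit _) (h.zero_lt _ _ Fin.castSucc_lt_succ).le (zero_at _)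
      fun _ hj => h.strictMono.monotone (Fin.castSucc_lt_succ_iff.1 hj)

/-- Every point of a cut is a boundary value of the conformal map. -/
lemma exists_combMap_ofReal_eq (h : IsChebyshev α β x ξ M) (hα : 0 ≤ α) (hβ : 0 ≤ β)
    (hpos : 0 < α + β + n) {w : ℂ} {j : ℕ} (hj : j ≤ n) (him : w.im / Real.pi = j)
    (hre : w.re ≤ 0) :
    ∃ t : ℝ, IsRegular (masses α β n) (points x) t ∧ combMap α β M x t = w := by
  -- The cut at height j comes from the gap with j zeros to its right, hence the index n - j.
  obtain ⟨t, ht, htw, hz⟩ := h.exists_weighted_eq hα hβ hpos ⟨n - j, by omega⟩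
    (c := M * Real.exp w.re) (mul_pos h.pos (Real.exp_pos _))
    (mul_le_of_le_one_right h.pos.le (Real.exp_le_one_iff.2 hre))
  have hw : 0 < weighted α β x t := by rw [htw]; exact mul_pos h.pos (Real.exp_pos _)
  have hr := isRegular_of_weighted_pos hw
  refine ⟨t, hr, Complex.ext ?_ ?_⟩
  · rw [combMap_re_ofReal h.pos ht hw, htw, mul_div_cancel_left₀ _ h.pos.ne', Real.log_exp]
  · have h1 := combMap_im_ofReal_of_mem (M := M) ht hr
    rw [hz] at h1
    have h2 : (combMap α β M x t).im / Real.pi = w.im / Real.pi := by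
      rw [h1, him]
      congr 1
      simp only
      omega
    exact (div_left_inj' Real.pi_ne_zero).1 h2

/-- A value on a cut would also be a boundary value at some real t. By openness, values taken near t
are then taken near z as well, against injectivity. -/
lemma combMap_mem_domain (h : IsChebyshev α β x ξ M) (hα : 0 ≤ α) (hβ : 0 ≤ β)
    (hpos : 0 < α + β + n) {z : ℂ} (hz : z ∈ upperHalf) : combMap α β M x z ∈ domain n α β := by
  refine mem_domain_iff.2 ⟨combMap_mem_strip hα hβ hpos hz, fun j hj him => ?_⟩
  by_contra! hre
  obtain ⟨t, ht, htz⟩ := h.exists_combMap_ofReal_eq hα hβ hpos hj him hre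
  have hne : z ≠ t := by
    rintro rfl
    simp [upperHalf] at hz
  obtain ⟨U, V, hU, hV, hzU, htV, hUV⟩ := t2_separation hne
  have h1 : combMap α β M x '' (U ∩ upperHalf) ∈ 𝓝 (combMap α β M x z) := by
    rw [← map_nhds_combMap hα hβ hpos hz]
    exact image_mem_map (inter_mem (hU.mem_nhds hzU) (isOpen_upperHalf.mem_nhds hz))
  have h2 := tendsto_combMap_of_isRegular (M := M) ht
  rw [htz] at h2
  have h3 : ∀ᶠ y in 𝓝[upperHalf] (t : ℂ), y ∈ V := nhdsWithin_le_nhds (hV.mem_nhds htV)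
  have := nhdsWithin_upperHalf_neBot t
  obtain ⟨y, ⟨⟨y', hy', hyy'⟩, hyV⟩, hyH⟩ := ((h2.eventually h1).and h3).and self_mem_nhdsWithin |>.exists
  have : y' = y := injOn_combMap hα hβ hpos hy'.2 hyH hyy'
  exact disjoint_left.1 hUV hy'.1 (this ▸ hyV)

lemma bijOn_combMap (h : IsChebyshev α β x ξ M) (hα : 0 ≤ α) (hβ : 0 ≤ β)
    (hpos : 0 < α + β + n) : BijOn (combMap α β M x) upperHalf (domain n α β) :=
  ⟨fun _ hz => h.combMap_mem_domain hα hβ hpos hz, injOn_combMap hα hβ hpos,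
    h.domain_subset_image hα hβ hpos⟩

end IsChebyshev

end CombMap

/-! ### Boundary behaviour and uniqueness of the normalized map. -/

section Boundary

open Filter Topology Set Complex

lemma logSum_re_lt {ι : Type*} [Fintype ι] {m p : ι → ℝ} (hm : ∀ i, 0 ≤ m i) (hm' : ∃ i, 0 < m i)
    {s t : ℝ} (h : ∀ i, m i ≠ 0 → 0 < |s - p i| ∧ |s - p i| < |t - p i|) :
    (logSum m p s).re < (logSum m p t).re := by
  rw [logSum_ofReal_re, logSum_ofReal_re]
  obtain ⟨k, hk⟩ := hm'
  refine Finset.sum_lt_sum (fun i _ => ?_) ⟨k, Finset.mem_univ _, ?_⟩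
  · by_cases hi : m i = 0
    · simp [hi]
    · exact mul_le_mul_of_nonneg_left (Real.log_le_log (h i hi).1 (h i hi).2.le) (hm i)
  · exact mul_lt_mul_of_pos_left (Real.log_lt_log (h k hk.ne').1 (h k hk.ne').2) hk

section

variable {α β M : ℝ} {n : ℕ} {x : Fin n → ℝ} {ξ : Fin (n + 1) → ℝ}

lemma combMap_re_lt_of_lt (hα : 0 ≤ α) (hβ : 0 ≤ β) (hpos : 0 < α + β + n) {s t : ℝ} (hst : s < t)
    (h : ∀ i, masses α β n i ≠ 0 → t < points x i) :
    (combMap α β M x t).re < (combMap α β M x s).re := by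
  rw [combMap_re, combMap_re]
  refine sub_lt_sub_right (logSum_re_lt (masses_nonneg hα hβ) (exists_masses_pos hpos) ?_) _
  intro i hi
  have := h i hi
  rw [abs_of_neg (by linarith), abs_of_neg (by linarith)]
  constructor <;> linarith

lemma combMap_re_lt_of_gt (hα : 0 ≤ α) (hβ : 0 ≤ β) (hpos : 0 < α + β + n) {s t : ℝ} (hst : t < s)
    (h : ∀ i, masses α β n i ≠ 0 → points x i < t) :
    (combMap α β M x t).re < (combMap α β M x s).re := by
  rw [combMap_re, combMap_re]
  refine sub_lt_sub_right (logSum_re_lt (masses_nonneg hα hβ) (exists_masses_pos hpos) ?_) _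
  intro i hi
  have := h i hi
  rw [abs_of_pos (by linarith), abs_of_pos (by linarith)]
  constructor <;> linarith

lemma forall_masses_iff {P : ℝ → Prop} : (∀ i, masses α β n i ≠ 0 → P (points x i)) ↔
    (∀ j, P (x j)) ∧ (α ≠ 0 → P 0) ∧ (β ≠ 0 → P 1) := by
  simp [Sum.forall, Fin.forall_fin_two, masses, points]

lemma hasExpansion_combMap :
    HasExpansion n α β (combMap α β M x) (-Real.log M) := by
  refine (logSum_sub_isBigO (masses α β n) (points x)).congr_left fun z => ?_
  rw [sum_masses, combMap]
  ring

/-- The limit of `Im w / π` along the vertical line through `t`. -/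
def verticalLimit (α β : ℝ) (x : Fin n → ℝ) (t : ℝ) : ℝ :=
  (∑ i, masses α β n i * halfStep t (points x i)) - β

lemma tendsto_combMap_im_vertical (t : ℝ) :
    Tendsto (fun s : ℝ => (combMap α β M x (t + s * I)).im / Real.pi) (𝓝[>] 0)
      (𝓝 (verticalLimit α β x t)) := by
  simp only [combMap_im_div_pi]
  have := (tendsto_logSum_im_vertical (masses α β n) (points x) t).div_const Real.pi
  rw [mul_div_cancel_left₀ _ Real.pi_ne_zero] at this
  exact this.sub_const β

end

namespace IsChebyshev

variable {α β M : ℝ} {n : ℕ} {x : Fin n → ℝ} {ξ : Fin (n + 1) → ℝ}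

/-- Together with `lt_verticalLimit_zero` this singles out 0 among the singular points as the only
one approached above the top cut; `verticalLimit_pos` does the same for 1 below the bottom cut. -/
lemma verticalLimit_lt (h : IsChebyshev α β x ξ M) (hβ : 0 ≤ β) {i : Fin n ⊕ Fin 2}
    (hi : masses α β n i ≠ 0) (hi0 : i ≠ Sum.inr 0) : verticalLimit α β x (points x i) < n := by
  rw [verticalLimit, sum_masses_mul]
  rcases i with j | j
  · have hs : ∑ k, halfStep (x j) (x k) < n := by
      refine (Finset.sum_lt_sum (fun k _ => halfStep_le_one _ _)
        ⟨j, Finset.mem_univ _, ?_⟩).trans_eq (by simp : ∑ _ : Fin n, (1 : ℝ) = n)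
      rw [halfStep_self]
      norm_num
    simp only [points, Sum.elim_inl, Sum.elim_inr, Matrix.cons_val_zero, Matrix.cons_val_one,
      halfStep_of_gt (h.zero_pos j), halfStep_of_lt (h.zero_lt_one j)]
    linarith
  · fin_cases j
    · exact absurd rfl hi0
    · have hβ' : 0 < β := hβ.lt_of_ne' (by simpa [masses] using hi)
      simp [points, halfStep_of_gt (h.zero_lt_one _), halfStep_self, halfStep_of_gt one_pos]
      have : (0 : ℝ) ≤ n := n.cast_nonneg
      linarith

lemma verticalLimit_pos (h : IsChebyshev α β x ξ M) (hα : 0 ≤ α) {i : Fin n ⊕ Fin 2}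
    (hi : masses α β n i ≠ 0) (hi1 : i ≠ Sum.inr 1) : 0 < verticalLimit α β x (points x i) := by
  rw [verticalLimit, sum_masses_mul]
  rcases i with j | j
  · have hs : 0 < ∑ k, halfStep (x j) (x k) := by
      refine Finset.sum_pos' (fun k _ => halfStep_nonneg _ _) ⟨j, Finset.mem_univ _, ?_⟩
      rw [halfStep_self]
      norm_num
    simp only [points, Sum.elim_inl, Sum.elim_inr, Matrix.cons_val_zero, Matrix.cons_val_one,
      halfStep_of_gt (h.zero_pos j), halfStep_of_lt (h.zero_lt_one j)]
    linarith
  · fin_cases j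
    · have hα' : 0 < α := hα.lt_of_ne' (by simpa [masses] using hi)
      simp [points, halfStep_of_lt (h.zero_pos _), halfStep_self, halfStep_of_lt one_pos]
      have : (0 : ℝ) ≤ n := n.cast_nonneg
      linarith
    · exact absurd rfl hi1

lemma lt_verticalLimit_zero (h : IsChebyshev α β x ξ M) (hα : 0 < α) :
    n < verticalLimit α β x (points x (Sum.inr 0)) := by
  rw [verticalLimit, sum_masses_mul]
  simp [points, halfStep_of_lt (h.zero_pos _), halfStep_self, halfStep_of_lt one_pos]
  linarith

lemma verticalLimit_one_lt (h : IsChebyshev α β x ξ M) (hβ : 0 < β) :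
    verticalLimit α β x (points x (Sum.inr 1)) < 0 := by
  rw [verticalLimit, sum_masses_mul]
  simp [points, halfStep_of_gt (h.zero_lt_one _), halfStep_self, halfStep_of_gt one_pos]
  linarith

/-- Near a singular boundary point, the conformal map stays on one side of every cut. -/
lemma eventually_side (h : IsChebyshev α β x ξ M) (hα : 0 ≤ α) (hβ : 0 ≤ β)
    (hpos : 0 < α + β + n) {i : Fin n ⊕ Fin 2} (hi : masses α β n i ≠ 0) {j : ℕ} (hj : j ≤ n) :
    (∀ᶠ z in 𝓝[upperHalf] (points x i : ℂ), (combMap α β M x z).im / Real.pi < j) ∨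
    ∀ᶠ z in 𝓝[upperHalf] (points x i : ℂ), j < (combMap α β M x z).im / Real.pi := by
  -- On a small half-disc the real part is negative, so the image avoids the whole line containing
  -- the cut; connectedness keeps it on one side.
  have hre := (tendsto_combMap_re_atBot (M := M) (x := x) hα hβ hi).eventually_lt_atBot 0
  obtain ⟨ε, hε, hsub⟩ := Metric.mem_nhdsWithin_iff.1 hre
  set S := Metric.ball (points x i : ℂ) ε ∩ upperHalf with hS
  have hSn : S ∈ 𝓝[upperHalf] (points x i : ℂ) :=
    inter_mem (nhdsWithin_le_nhds (Metric.ball_mem_nhds _ hε)) self_mem_nhdsWithin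
  have hSc : IsPreconnected S := ((convex_ball _ _).inter convex_upperHalf).isPreconnected
  have hcont : ContinuousOn (fun z => (combMap α β M x z).im / Real.pi) S :=
    (continuous_im.comp_continuousOn
      (continuousOn_combMap.mono inter_subset_right)).div_const _
  have hne : ∀ z ∈ S, (combMap α β M x z).im / Real.pi ≠ j := fun z hz he =>
    ((mem_domain_iff.1 (h.combMap_mem_domain hα hβ hpos hz.2)).2 j hj he).not_gt (hsub hz)
  by_cases hall : ∀ z ∈ S, (combMap α β M x z).im / Real.pi < j
  · exact Or.inl (mem_of_superset hSn hall)
  · push Not at hall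
    obtain ⟨z₀, hz₀, hz₀j⟩ := hall
    refine Or.inr (mem_of_superset hSn fun z hz => ?_)
    by_contra hzj
    obtain ⟨y, hy, hyj⟩ := hSc.intermediate_value hz hz₀ hcont ⟨not_lt.1 hzj, hz₀j⟩
    exact hne y hy hyj

lemma eventually_lt_of_verticalLimit_lt (h : IsChebyshev α β x ξ M) (hα : 0 ≤ α) (hβ : 0 ≤ β)
    (hpos : 0 < α + β + n) {i : Fin n ⊕ Fin 2} (hi : masses α β n i ≠ 0) {j : ℕ} (hj : j ≤ n)
    (hlim : verticalLimit α β x (points x i) < j) :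
    ∀ᶠ z in 𝓝[upperHalf] (points x i : ℂ), (combMap α β M x z).im / Real.pi < j := by
  refine (h.eventually_side hα hβ hpos hi hj).resolve_right fun hev => ?_
  obtain ⟨s, hs, hs'⟩ := (((tendsto_combMap_im_vertical (M := M) _).eventually_lt_const hlim).and
    ((tendsto_vertical _).eventually hev)).exists
  exact lt_asymm hs hs'

lemma eventually_gt_of_lt_verticalLimit (h : IsChebyshev α β x ξ M) (hα : 0 ≤ α) (hβ : 0 ≤ β)
    (hpos : 0 < α + β + n) {i : Fin n ⊕ Fin 2} (hi : masses α β n i ≠ 0) {j : ℕ} (hj : j ≤ n)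
    (hlim : j < verticalLimit α β x (points x i)) :
    ∀ᶠ z in 𝓝[upperHalf] (points x i : ℂ), j < (combMap α β M x z).im / Real.pi := by
  refine (h.eventually_side hα hβ hpos hi hj).resolve_left fun hev => ?_
  obtain ⟨s, hs, hs'⟩ := (((tendsto_combMap_im_vertical (M := M) _).eventually_const_lt hlim).and
    ((tendsto_vertical _).eventually hev)).exists
  exact lt_asymm hs hs'

lemma combMap_re_point (h : IsChebyshev α β x ξ M) (i : Fin (n + 1)) :
    (combMap α β M x (ξ i)).re = 0 := by
  rw [combMap_re_ofReal h.pos (h.mem i) (by rw [h.eq]; exact h.pos), h.eq, div_self h.pos.ne',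
    Real.log_one]

lemma isRegular_point (h : IsChebyshev α β x ξ M) (i : Fin (n + 1)) :
    IsRegular (masses α β n) (points x) (ξ i) :=
  isRegular_of_weighted_pos (by rw [h.eq]; exact h.pos)

lemma isRegular_zero (h : IsChebyshev 0 β x ξ M) : IsRegular (masses 0 β n) (points x) 0 :=
  isRegular_iff.2 ⟨fun j => (h.zero_pos j).ne', fun h => absurd rfl h, fun _ => one_ne_zero⟩

lemma isRegular_one (h : IsChebyshev α 0 x ξ M) : IsRegular (masses α 0 n) (points x) 1 :=
  isRegular_iff.2 ⟨fun j => (h.zero_lt_one j).ne, fun _ => zero_ne_one, fun h => absurd rfl h⟩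

/-- All masses lie to the right of ξ 0, so moving left from ξ 0 to 0 cannot lower the real part. It
is 0 at ξ 0 and at most 0 on [0, 1], hence 0 at the origin. -/
lemma combMap_zero (h : IsChebyshev 0 β x ξ M) (hβ : 0 ≤ β) (hpos : 0 < 0 + β + n) :
    combMap 0 β M x (0 : ℝ) = (n : ℂ) * Real.pi * I := by
  have hr := h.isRegular_zero
  have hmem : (0 : ℝ) ∈ Icc (0 : ℝ) 1 := ⟨le_rfl, zero_le_one⟩
  refine Complex.ext ?_ ?_
  · have e : ((n : ℂ) * Real.pi * I).re = 0 := by simp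
    rw [e]
    refine le_antisymm (h.combMap_re_nonpos hmem hr) ?_
    refine (h.combMap_re_point 0).ge.trans ?_
    rcases (h.mem 0).1.eq_or_lt with h0 | h0
    · rw [← h0]
    · refine (combMap_re_lt_of_lt le_rfl hβ hpos h0 (forall_masses_iff (P := fun q => ξ 0 < q) |>.2
        ⟨fun j => h.lt_zero 0 j (Fin.zero_le _), fun h => absurd rfl h, fun hb => ?_⟩)).le
      exact (h.mem 0).2.lt_of_ne ((isRegular_iff.1 (h.isRegular_point 0)).2.2 hb).symm
  · have h1 := combMap_im_ofReal_of_mem (M := M) hmem hr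
    rw [h.zerosAbove_of_neg le_rfl, div_eq_iff Real.pi_ne_zero] at h1
    rw [h1]
    simp

lemma combMap_one (h : IsChebyshev α 0 x ξ M) (hα : 0 ≤ α) (hpos : 0 < α + 0 + n) :
    combMap α 0 M x (1 : ℝ) = 0 := by
  have hr := h.isRegular_one
  have hmem : (1 : ℝ) ∈ Icc (0 : ℝ) 1 := ⟨zero_le_one, le_rfl⟩
  refine Complex.ext ?_ ?_
  · rw [zero_re]
    refine le_antisymm (h.combMap_re_nonpos hmem hr) ?_
    refine (h.combMap_re_point (Fin.last n)).ge.trans ?_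
    rcases (h.mem (Fin.last n)).2.eq_or_lt with h0 | h0
    · rw [h0]
    · refine (combMap_re_lt_of_gt hα le_rfl hpos h0 (forall_masses_iff (P := fun q => q < ξ (Fin.last n)) |>.2
        ⟨fun j => h.zero_lt _ j (Fin.castSucc_lt_last j), fun ha => ?_, fun h => absurd rfl h⟩)).le
      exact (h.mem (Fin.last n)).1.lt_of_ne
        ((isRegular_iff.1 (h.isRegular_point (Fin.last n))).2.1 ha)
  · have h1 := combMap_im_ofReal_of_mem (M := M) hmem hr
    rw [h.zerosAbove_of_one_le le_rfl, div_eq_iff Real.pi_ne_zero] at h1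
    rw [h1]
    simp

/-- The imaginary part nπ places t to the left of every mass, where the real part is strictly
decreasing; so the tip of the top cut is hit only once. -/
lemma eq_zero_of_combMap_eq (h : IsChebyshev 0 β x ξ M) (hβ : 0 ≤ β) (hpos : 0 < 0 + β + n) {t : ℝ}
    (he : combMap 0 β M x t = (n : ℂ) * Real.pi * I) : t = 0 := by
  have him : (combMap 0 β M x t).im / Real.pi = n := by
    rw [he]
    simp
  rw [combMap_im_ofReal] at him
  have hz : (zerosAbove x t : ℝ) ≤ n := by exact_mod_cast zerosAbove_le x t
  have ht1 : β ≠ 0 → t < 1 := by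
    intro hb
    by_contra hc
    rw [if_neg hc] at him
    have := hβ.lt_of_ne' hb
    linarith
  have hn : zerosAbove x t = n := by
    have : β * (if t < 1 then 1 else 0) = β := by
      by_cases hb : β = 0
      · simp [hb]
      · rw [if_pos (ht1 hb), mul_one]
    rw [this] at him
    have : (zerosAbove x t : ℝ) = n := by linarith
    exact_mod_cast this
  have hx : ∀ j, t < x j := by
    have h1 : (Finset.univ.filter fun j => t < x j) = Finset.univ :=
      Finset.eq_univ_of_card _ (by rw [Fintype.card_fin]; exact hn)
    intro j
    have : j ∈ Finset.univ.filter fun j => t < x j := by rw [h1]; exact Finset.mem_univ _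
    simpa using this
  have hre : (combMap 0 β M x t).re = (combMap 0 β M x (0 : ℝ)).re := by
    rw [he, h.combMap_zero hβ hpos]
  rcases lt_trichotomy t 0 with h0 | h0 | h0
  · exact absurd hre (combMap_re_lt_of_lt le_rfl hβ hpos h0 (forall_masses_iff (P := fun q => 0 < q) |>.2
      ⟨h.zero_pos, fun h => absurd rfl h, fun _ => one_pos⟩)).ne'
  · exact h0
  · exact absurd hre (combMap_re_lt_of_lt le_rfl hβ hpos h0 (forall_masses_iff (P := fun q => t < q) |>.2
      ⟨hx, fun h => absurd rfl h, ht1⟩)).ne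

/-- Mirror image of `eq_zero_of_combMap_eq`. Regularity of t is needed because the imaginary part
does not register a mass located exactly at t. -/
lemma eq_one_of_combMap_eq (h : IsChebyshev α 0 x ξ M) (hα : 0 ≤ α) (hpos : 0 < α + 0 + n) {t : ℝ}
    (ht : IsRegular (masses α 0 n) (points x) t) (he : combMap α 0 M x t = 0) : t = 1 := by
  have him : (combMap α 0 M x t).im / Real.pi = 0 := by simp [he]
  rw [combMap_im_ofReal, zero_mul, add_zero, sub_zero] at him
  obtain ⟨hr1, hr2, -⟩ := isRegular_iff.1 ht
  have hz : (0 : ℝ) ≤ zerosAbove x t := Nat.cast_nonneg _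
  have ht0 : α ≠ 0 → 0 < t := by
    intro ha
    by_contra hc
    rw [if_pos ((not_lt.1 hc).lt_of_ne (hr2 ha).symm)] at him
    have := hα.lt_of_ne' ha
    linarith
  have hn : zerosAbove x t = 0 := by
    have : 0 ≤ α * (if t < 0 then 1 else 0) := mul_nonneg hα (by split_ifs <;> norm_num)
    have : (zerosAbove x t : ℝ) = 0 := by linarith
    exact_mod_cast this
  have hx : ∀ j, x j < t := by
    intro j
    have := Finset.card_eq_zero.1 hn
    have : j ∉ Finset.univ.filter fun j => t < x j := by rw [this]; exact Finset.notMem_empty _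
    have : x j ≤ t := by simpa using this
    exact this.lt_of_ne (hr1 j)
  have hre : (combMap α 0 M x t).re = (combMap α 0 M x (1 : ℝ)).re := by
    rw [he, h.combMap_one hα hpos]
  rcases lt_trichotomy t 1 with h0 | h0 | h0
  · exact absurd hre (combMap_re_lt_of_gt hα le_rfl hpos h0 (forall_masses_iff (P := fun q => q < t) |>.2
      ⟨hx, ht0, fun h => absurd rfl h⟩)).ne
  · exact h0
  · exact absurd hre (combMap_re_lt_of_gt hα le_rfl hpos h0 (forall_masses_iff (P := fun q => q < 1) |>.2
      ⟨h.zero_lt_one, fun _ => one_pos, fun h => absurd rfl h⟩)).ne'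

theorem isMap_combMap (h : IsChebyshev α β x ξ M) (hα : 0 ≤ α) (hβ : 0 ≤ β)
    (hpos : 0 < α + β + n) : IsMap n α β (combMap α β M x) where
  differentiableOn := differentiableOn_combMap
  bijOn := h.bijOn_combMap hα hβ hpos
  at_zero_of_pos ha := by
    have hi : masses α β n (Sum.inr 0) ≠ 0 := ha.ne'
    have h1 := tendsto_combMap_re_atBot (M := M) (x := x) hα hβ hi
    have h2 := h.eventually_gt_of_lt_verticalLimit hα hβ hpos hi le_rfl (h.lt_verticalLimit_zero ha)
    rw [show ((points x (Sum.inr 0) : ℝ) : ℂ) = 0 from ofReal_zero] at h1 h2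
    refine ⟨h1, ?_⟩
    filter_upwards [h2, self_mem_nhdsWithin] with z hz hzH
    exact ⟨hz, by linarith [(combMap_mem_strip (M := M) (x := x) hα hβ hpos hzH).2]⟩
  at_zero_of_eq ha := by
    subst ha
    have h1 := tendsto_combMap_of_isRegular (M := M) h.isRegular_zero
    rwa [h.combMap_zero hβ hpos, ofReal_zero] at h1
  at_one_of_pos hb := by
    have hi : masses α β n (Sum.inr 1) ≠ 0 := hb.ne'
    have h1 := tendsto_combMap_re_atBot (M := M) (x := x) hα hβ hi
    have h2 := h.eventually_lt_of_verticalLimit_lt hα hβ hpos hi n.zero_le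
      ((h.verticalLimit_one_lt hb).trans_eq Nat.cast_zero.symm)
    rw [show ((points x (Sum.inr 1) : ℝ) : ℂ) = 1 from ofReal_one] at h1 h2
    refine ⟨h1, ?_⟩
    filter_upwards [h2, self_mem_nhdsWithin] with z hz hzH
    exact ⟨(combMap_mem_strip (M := M) (x := x) hα hβ hpos hzH).1, by simpa using hz⟩
  at_one_of_eq hb := by
    subst hb
    have h1 := tendsto_combMap_of_isRegular (M := M) h.isRegular_one
    rwa [h.combMap_one hα hpos, ofReal_one] at h1
  at_infty := tendsto_combMap_re_atTop hpos

/-! ### Uniqueness -/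

/-- Along an ultrafilter, an inverse image of a curve tends to the boundary point at which the
conformal map has the prescribed behaviour. -/
lemma ultrafilter_le_nhds_zero (h : IsChebyshev α β x ξ M) (hα : 0 ≤ α) (hβ : 0 ≤ β)
    (hpos : 0 < α + β + n) (G : Ultrafilter ℂ) (hG : (G : Filter ℂ) ≤ 𝓟 upperHalf)
    (hG1 : 0 < α → Tendsto (fun z => (combMap α β M x z).re) G atBot ∧
      ∀ᶠ z in (G : Filter ℂ), (n : ℝ) < (combMap α β M x z).im / Real.pi)
    (hG2 : α = 0 → Tendsto (combMap α β M x) G (𝓝 ((n : ℂ) * Real.pi * I))) :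
    (G : Filter ℂ) ≤ 𝓝 0 := by
  -- Every location other than 0 is incompatible with the prescribed limit: by the real part, by the
  -- side of the top cut, or by uniqueness of the preimage of its tip.
  rcases ultrafilter_cases (masses α β n) (points x) G hG with
    h1 | ⟨i, hi, h1⟩ | ⟨t, ht, h1⟩ | ⟨z, hz, h1⟩
  · have h2 := (tendsto_combMap_re_atTop (M := M) (x := x) hpos).mono_left h1
    rcases hα.eq_or_lt with h0 | h0
    · exact absurd ((continuous_re.tendsto _).comp (hG2 h0.symm))
        (not_tendsto_nhds_of_tendsto_atTop h2 _)
    · exact absurd (hG1 h0).1 (h2.not_tendsto disjoint_atTop_atBot)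
  · have h2 := (tendsto_combMap_re_atBot (M := M) (x := x) hα hβ hi).mono_left h1
    rcases hα.eq_or_lt with h0 | h0
    · exact absurd ((continuous_re.tendsto _).comp (hG2 h0.symm))
        (not_tendsto_nhds_of_tendsto_atBot h2 _)
    · by_cases hi0 : i = Sum.inr 0
      · subst hi0
        have : ((points x (Sum.inr 0) : ℝ) : ℂ) = 0 := ofReal_zero
        rw [this] at h1
        exact h1.trans nhdsWithin_le_nhds
      · have h3 := h1 (h.eventually_lt_of_verticalLimit_lt hα hβ hpos hi le_rfl
          (h.verticalLimit_lt hβ hi hi0))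
        have h4 := ((hG1 h0).2.and h3).exists
        obtain ⟨z, hz, hz'⟩ := h4
        exact absurd hz (lt_asymm hz')
  · have h2 := (tendsto_combMap_of_isRegular (M := M) ht).mono_left h1
    rcases hα.eq_or_lt with h0 | h0
    · have h3 := tendsto_nhds_unique h2 (hG2 h0.symm)
      subst h0
      have := h.eq_zero_of_combMap_eq hβ hpos h3
      rw [this, ofReal_zero] at h1
      exact h1.trans nhdsWithin_le_nhds
    · exact absurd ((continuous_re.tendsto _).comp h2)
        (not_tendsto_nhds_of_tendsto_atBot (hG1 h0).1 _)
  · have hc := (continuousOn_combMap (α := α) (β := β) (M := M) (x := x)).continuousAt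
      (isOpen_upperHalf.mem_nhds hz)
    have h2 := hc.tendsto.mono_left h1
    rcases hα.eq_or_lt with h0 | h0
    · have h3 := tendsto_nhds_unique h2 (hG2 h0.symm)
      have h4 := (mem_domain_iff.1 (h.combMap_mem_domain hα hβ hpos hz)).2 n le_rfl
        (by rw [h3]; simp)
      rw [h3] at h4
      simp at h4
    · exact absurd ((continuous_re.tendsto _).comp h2)
        (not_tendsto_nhds_of_tendsto_atBot (hG1 h0).1 _)

lemma ultrafilter_le_nhds_one (h : IsChebyshev α β x ξ M) (hα : 0 ≤ α) (hβ : 0 ≤ β)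
    (hpos : 0 < α + β + n) (G : Ultrafilter ℂ) (hG : (G : Filter ℂ) ≤ 𝓟 upperHalf)
    (hG1 : 0 < β → Tendsto (fun z => (combMap α β M x z).re) G atBot ∧
      ∀ᶠ z in (G : Filter ℂ), (combMap α β M x z).im / Real.pi < 0)
    (hG2 : β = 0 → Tendsto (combMap α β M x) G (𝓝 0)) :
    (G : Filter ℂ) ≤ 𝓝 1 := by
  rcases ultrafilter_cases (masses α β n) (points x) G hG with
    h1 | ⟨i, hi, h1⟩ | ⟨t, ht, h1⟩ | ⟨z, hz, h1⟩
  · have h2 := (tendsto_combMap_re_atTop (M := M) (x := x) hpos).mono_left h1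
    rcases hβ.eq_or_lt with h0 | h0
    · exact absurd ((continuous_re.tendsto _).comp (hG2 h0.symm))
        (not_tendsto_nhds_of_tendsto_atTop h2 _)
    · exact absurd (hG1 h0).1 (h2.not_tendsto disjoint_atTop_atBot)
  · have h2 := (tendsto_combMap_re_atBot (M := M) (x := x) hα hβ hi).mono_left h1
    rcases hβ.eq_or_lt with h0 | h0
    · exact absurd ((continuous_re.tendsto _).comp (hG2 h0.symm))
        (not_tendsto_nhds_of_tendsto_atBot h2 _)
    · by_cases hi0 : i = Sum.inr 1
      · subst hi0
        have : ((points x (Sum.inr 1) : ℝ) : ℂ) = 1 := ofReal_one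
        rw [this] at h1
        exact h1.trans nhdsWithin_le_nhds
      · have h3 := h1 (h.eventually_gt_of_lt_verticalLimit hα hβ hpos hi n.zero_le
          (Nat.cast_zero.trans_lt (h.verticalLimit_pos hα hi hi0)))
        have h4 := ((hG1 h0).2.and h3).exists
        obtain ⟨z, hz, hz'⟩ := h4
        rw [Nat.cast_zero] at hz'
        exact absurd hz (lt_asymm hz')
  · have h2 := (tendsto_combMap_of_isRegular (M := M) ht).mono_left h1
    rcases hβ.eq_or_lt with h0 | h0
    · have h3 := tendsto_nhds_unique h2 (hG2 h0.symm)
      subst h0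
      have := h.eq_one_of_combMap_eq hα hpos ht h3
      rw [this, ofReal_one] at h1
      exact h1.trans nhdsWithin_le_nhds
    · exact absurd ((continuous_re.tendsto _).comp h2)
        (not_tendsto_nhds_of_tendsto_atBot (hG1 h0).1 _)
  · have hc := (continuousOn_combMap (α := α) (β := β) (M := M) (x := x)).continuousAt
      (isOpen_upperHalf.mem_nhds hz)
    have h2 := hc.tendsto.mono_left h1
    rcases hβ.eq_or_lt with h0 | h0
    · have h3 := tendsto_nhds_unique h2 (hG2 h0.symm)
      have h4 := (mem_domain_iff.1 (h.combMap_mem_domain hα hβ hpos hz)).2 0 n.zero_le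
        (by rw [h3]; simp)
      rw [h3] at h4
      simp at h4
    · exact absurd ((continuous_re.tendsto _).comp h2)
        (not_tendsto_nhds_of_tendsto_atBot (hG1 h0).1 _)

lemma ultrafilter_le_cobounded (hα : 0 ≤ α) (hβ : 0 ≤ β)
    (G : Ultrafilter ℂ) (hG : (G : Filter ℂ) ≤ 𝓟 upperHalf)
    (hG1 : Tendsto (fun z => (combMap α β M x z).re) G atTop) :
    (G : Filter ℂ) ≤ Bornology.cobounded ℂ := by
  rcases ultrafilter_cases (masses α β n) (points x) G hG with
    h1 | ⟨i, hi, h1⟩ | ⟨t, ht, h1⟩ | ⟨z, hz, h1⟩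
  · exact h1.trans inf_le_left
  · exact absurd hG1 (((tendsto_combMap_re_atBot hα hβ hi).mono_left h1).not_tendsto
      disjoint_atBot_atTop)
  · exact absurd ((continuous_re.tendsto _).comp ((tendsto_combMap_of_isRegular ht).mono_left h1))
      (not_tendsto_nhds_of_tendsto_atTop hG1 _)
  · have hc := (continuousOn_combMap (α := α) (β := β) (M := M) (x := x)).continuousAt
      (isOpen_upperHalf.mem_nhds hz)
    exact absurd ((continuous_re.tendsto _).comp (hc.tendsto.mono_left h1))
      (not_tendsto_nhds_of_tendsto_atTop hG1 _)

/-- The composition of w with the inverse of the comb map is an automorphism of the half-plane; the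
boundary conditions force it to fix 0, 1 and ∞. No extension to the boundary is needed, as limits
are tested on ultrafilters. -/
theorem eqOn_combMap (h : IsChebyshev α β x ξ M) (hα : 0 ≤ α) (hβ : 0 ≤ β)
    (hpos : 0 < α + β + n) {w : ℂ → ℂ} (hw : IsMap n α β w) :
    EqOn w (combMap α β M x) upperHalf := by
  have hb := h.bijOn_combMap hα hβ hpos
  set u := Function.invFunOn (combMap α β M x) upperHalf with hu
  set v := Function.invFunOn w upperHalf with hv
  have hum : MapsTo u (domain n α β) upperHalf := hb.surjOn.mapsTo_invFunOn
  have hvm : MapsTo v (domain n α β) upperHalf := hw.bijOn.surjOn.mapsTo_invFunOn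
  have hφm : MapsTo (u ∘ w) upperHalf upperHalf := hum.comp hw.bijOn.mapsTo
  have hφ : ∀ z ∈ upperHalf, combMap α β M x ((u ∘ w) z) = w z := fun z hz =>
    hb.surjOn.rightInvOn_invFunOn (hw.bijOn.mapsTo hz)
  -- The comb map carries the pushed-forward ultrafilter to the image of g under w, so it inherits
  -- the boundary behaviour of w.
  have hultra : ∀ g : Ultrafilter ℂ, (g : Filter ℂ) ≤ 𝓟 upperHalf →
      ((g.map (u ∘ w) : Ultrafilter ℂ) : Filter ℂ) ≤ 𝓟 upperHalf ∧
      map (combMap α β M x) (g.map (u ∘ w) : Ultrafilter ℂ) = map w g := by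
    intro g hg
    constructor
    · rw [Ultrafilter.coe_map]
      exact (map_mono hg).trans (by rw [map_principal, principal_mono]; exact hφm.image_subset)
    · rw [Ultrafilter.coe_map, Filter.map_map]
      exact map_congr (mem_of_superset (le_principal_iff.1 hg) hφ)
  have key : ∀ z ∈ upperHalf, (u ∘ w) z = z := by
    refine eq_self_of_fix_zero_one_infty (ψ := v ∘ combMap α β M x)
      ((differentiableOn_invFunOn isOpen_upperHalf differentiableOn_combMap hb).comp
        hw.differentiableOn hw.bijOn.mapsTo)
      ((differentiableOn_invFunOn isOpen_upperHalf hw.differentiableOn hw.bijOn).comp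
        differentiableOn_combMap hb.mapsTo) hφm (hvm.comp hb.mapsTo) ?_ ?_ ?_ ?_
    · intro z hz
      rw [Function.comp_apply, hφ z hz]
      exact hw.bijOn.injOn.leftInvOn_invFunOn hz
    · refine tendsto_iff_ultrafilter _ _ _ |>.2 fun g hg => ?_
      obtain ⟨h1, h2⟩ := hultra g (hg.trans inf_le_right)
      refine h.ultrafilter_le_nhds_zero hα hβ hpos _ h1 (fun ha => ?_) fun ha => ?_
      · obtain ⟨h3, h4⟩ := hw.at_zero_of_pos ha
        constructor
        · have : Tendsto re (map w g) atBot := h3.mono_left hg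
          rw [← h2] at this
          exact this
        · have : ∀ᶠ y in map w g, (n : ℝ) < y.im / Real.pi := hg (h4.mono fun z hz => hz.1)
          rw [← h2] at this
          exact this
      · have : map w g ≤ 𝓝 ((n : ℂ) * Real.pi * I) := (hw.at_zero_of_eq ha).mono_left hg
        rw [← h2] at this
        exact this
    · refine tendsto_iff_ultrafilter _ _ _ |>.2 fun g hg => ?_
      obtain ⟨h1, h2⟩ := hultra g (hg.trans inf_le_right)
      refine h.ultrafilter_le_nhds_one hα hβ hpos _ h1 (fun ha => ?_) fun ha => ?_
      · obtain ⟨h3, h4⟩ := hw.at_one_of_pos ha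
        constructor
        · have : Tendsto re (map w g) atBot := h3.mono_left hg
          rw [← h2] at this
          exact this
        · have : ∀ᶠ y in map w g, y.im / Real.pi < 0 := hg (h4.mono fun z hz => hz.2)
          rw [← h2] at this
          exact this
      · have : map w g ≤ 𝓝 0 := (hw.at_one_of_eq ha).mono_left hg
        rw [← h2] at this
        exact this
    · refine tendsto_iff_ultrafilter _ _ _ |>.2 fun g hg => ?_
      obtain ⟨h1, h2⟩ := hultra g (hg.trans inf_le_right)
      refine ultrafilter_le_cobounded (M := M) (x := x) hα hβ _ h1 ?_
      have : Tendsto re (map w g) atTop := hw.at_infty.mono_left hg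
      rw [← h2] at this
      exact this
  intro z hz
  rw [← hφ z hz, key z hz]

/-! ### The expansion at infinity -/

theorem hasExpansion_iff (h : IsChebyshev α β x ξ M) (hα : 0 ≤ α) (hβ : 0 ≤ β)
    (hpos : 0 < α + β + n) {w : ℂ → ℂ} (hw : IsMap n α β w) (C : ℝ) :
    HasExpansion n α β w C ↔ C = -Real.log M := by
  have hev : w =ᶠ[Bornology.cobounded ℂ ⊓ 𝓟 upperHalf] combMap α β M x :=
    mem_of_superset (mem_inf_of_right (mem_principal_self _)) (h.eqOn_combMap hα hβ hpos hw)
  constructor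
  · intro hC
    have h1 := (hasExpansion_combMap (α := α) (β := β) (M := M) (x := x)).trans_tendsto
      tendsto_one_div_cobounded
    have h2 := hC.trans_tendsto tendsto_one_div_cobounded
    have h3 := h1.sub h2
    rw [sub_zero] at h3
    have h4 : Tendsto (fun _ : ℂ => (C : ℂ) - ((-Real.log M : ℝ) : ℂ))
        (Bornology.cobounded ℂ ⊓ 𝓟 upperHalf) (𝓝 0) := by
      refine h3.congr' ?_
      filter_upwards [hev] with z hz
      rw [hz]
      ring
    have h5 := tendsto_nhds_unique tendsto_const_nhds h4
    exact ofReal_injective (sub_eq_zero.1 h5)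
  · rintro rfl
    refine (hasExpansion_combMap (α := α) (β := β) (M := M) (x := x)).congr' ?_ EventuallyEq.rfl
    filter_upwards [hev] with z hz
    rw [hz]

/-- The comb map shows that the choice is not vacuous, and the expansion determines its value. -/
theorem constant_eq (h : IsChebyshev α β x ξ M) (hα : 0 ≤ α) (hβ : 0 ≤ β)
    (hpos : 0 < α + β + n) : constant n α β = -Real.log M := by
  have hex : ∃ C : ℝ, ∃ w : ℂ → ℂ, IsMap n α β w ∧ HasExpansion n α β w C :=
    ⟨_, _, h.isMap_combMap hα hβ hpos, hasExpansion_combMap⟩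
  obtain ⟨w, hw, hC⟩ := Classical.epsilon_spec hex
  exact (h.hasExpansion_iff hα hβ hpos hw _).1 hC

end IsChebyshev

end Boundary

end Comb

end

theorem theorem1 (k₁ l₁ k₂ l₂ : ℕ) (h₁ : l₁ ≤ k₁) (h₂ : l₂ ≤ k₂)
    (hdeg : 0 < k₁ + l₁ + k₂ + l₂) (α β : ℝ)
    (hα : α = ((k₁ : ℝ) - (l₁ : ℝ)) / 2) (hβ : β = ((k₂ : ℝ) - (l₂ : ℝ)) / 2) :
    0 < Comb.minDeviation k₁ l₁ k₂ l₂ ∧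
    (∃ w : ℂ → ℂ, Comb.IsMap (l₁ + l₂) α β w) ∧
    (∀ w w' : ℂ → ℂ, Comb.IsMap (l₁ + l₂) α β w → Comb.IsMap (l₁ + l₂) α β w' →
      Set.EqOn w w' Comb.upperHalf) ∧
    (∀ w : ℂ → ℂ, Comb.IsMap (l₁ + l₂) α β w → ∀ C : ℝ,
      Comb.HasExpansion (l₁ + l₂) α β w C ↔ C = Comb.constant (l₁ + l₂) α β) ∧
    Real.log (Comb.recipDeviation k₁ l₁ k₂ l₂) = Comb.constant (l₁ + l₂) α β := by
  obtain ⟨a, rfl⟩ := Nat.exists_eq_add_of_le h₁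
  obtain ⟨b, rfl⟩ := Nat.exists_eq_add_of_le h₂
  have hα' : α = a / 2 := by rw [hα]; push_cast; ring
  have hβ' : β = b / 2 := by rw [hβ]; push_cast; ring
  have hα0 : 0 ≤ α := by rw [hα']; positivity
  have hβ0 : 0 ≤ β := by rw [hβ']; positivity
  -- The total degree is 2(α + β + n), so positivity here is exactly N ≥ 1.
  have hpos : 0 < α + β + (l₁ + l₂ : ℕ) := by
    have : (0 : ℝ) < (l₁ + a + l₁ + (l₂ + b) + l₂ : ℕ) := by exact_mod_cast hdeg
    rw [hα', hβ']
    push_cast at this ⊢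
    linarith
  obtain ⟨x, ξ, M, h⟩ := Comb.exists_isChebyshev hα0 hβ0 (l₁ + l₂)
  have hM : Comb.minDeviation (l₁ + a) l₁ (l₂ + b) l₂ = M := by
    rw [hα', hβ'] at h
    exact Comb.minDeviation_eq h hdeg
  have hC := h.constant_eq hα0 hβ0 hpos
  refine ⟨hM ▸ h.pos, ⟨_, h.isMap_combMap hα0 hβ0 hpos⟩, fun w w' hw hw' z hz => ?_,
    fun w hw C => ?_, ?_⟩
  · rw [h.eqOn_combMap hα0 hβ0 hpos hw hz, h.eqOn_combMap hα0 hβ0 hpos hw' hz]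
  · rw [hC]
    exact h.hasExpansion_iff hα0 hβ0 hpos hw C
  · rw [Comb.recipDeviation, hM, hC, one_div, Real.log_inv]
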